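/- Let $P\subset\mathbb R^2$ be a non-empty finite set of $n$ points in general position (no three points of $P$ are collinear). Compare points from left to right by their $x$-coordinates, and points with equal $x$-coordinates by their $y$-coordinates; let $p_\ell$ and $p_r$ be the leftmost and the rightmost point of $P$, and assume that the segment $p_\ell p_r$ lies on the lower boundary of the convex hull of $P$, i.e. that every point of $P$ lies on or above the line $p_\ell p_r$. Let $\mathrm{ch}(P)$ be the set of points of $P$ on the boundary of the convex hull of $P$. **Algorithm.** Given an array $I_P$ that stores each point of $P$ once, in any order, the Kirkpatrick–McQueen–Seidel algorithm finds $p_\ell$ and $p_r$ by a scan and calls $A(P,(p_\ell,p_r))$. A call $A(S,(p,q))$ appends $p$ to the hull list and returns if $p=q$. Otherwise it computes the point $m\in S$ of rank $\lceil |S|/2\rceil$ in the left-to-right order (deterministic selection by medians of groups of five), and the edge $(r,s)$ of the upper convex hull of $S$ with $r$ equal to or to the left of $m$ and $s$ to the right of $m$ (bridge-finding by prune and search, as of Kirkpatrick and Seidel). It lets $S_1$ and $S_2$ be the sets of points of $S$ on or above the lines $pr$ and $sq$ (just $\{p\}$ if $r=p$, just $\{q\}$ if $s=q$), calls $A(S_1,(p,r))$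 and $A(S_2,(s,q))$, and assigns to each point of $S\setminus(S_1\cup S_2)$ a triangle with corners among $p,q,s,r$ as a witness for being internal. The running time $\rho(A,I_P)$ is the number of elementary steps (tests of bounded degree on the coordinates of boundedly many points, and function calls, including all passes through loops and recursions) made on input $I_P$. **Quadrangle tree.** A quadrangle tree of a convex polygon $C$ rooted at an edge $pq$ is empty if $p=q$. Otherwise, its root stores a quadrangle with corners $p,q,s,r$ in cyclic order, where $sr$ is an edge of $C$ and the coincidences $r=p$ and $s=q$ are allowed; if $r\ne p$ the root has as a child a quadrangle tree of the piece of $C$ cut off by $pr$, rooted at $pr$, and if $s\neq q$ it has as a child a quadrangle tree of the piece cut off by $qs$, rooted at $qs$. The *population* of a node with quadrangle $pqsr$ is the set of points of $P$ on or inside the quadrangle that do not lie on the line $pq$. For a quadrangle tree $\mathcal Q$ of the convex hull of $P$ rooted at $p_\ell p_r$, write $x\prec_{\mathcal Q}y$ if the node whose population contains $x$ is a strict ancestor of the node whose population contains $y$, or both nodes are the same and $y$ lies deeper than $x$ inside the half-plane that is bounded by the line through the root edge of that node and contains its polygon. **Ordered downdrafts.** An ordered downdraft of $(P,\mathcal Q)$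 is a map $\varphi:P\setminus\mathrm{ch}(P)\to P$ with $x\prec_{\mathcal Q}\varphi(x)$ for all $x$, together with a total order on each fiber $\varphi^{-1}(\{y\})$, $y\in P$. Let $\mathrm{OD}(P,\mathcal Q)$ be the set of all ordered downdrafts. **Theorem.** There is an absolute constant $c$ such that for every such $P$ the following holds. There is a quadrangle tree $\mathcal Q$ of the convex hull of $P$, rooted at $p_\ell p_r$, such that for every ordering $I_P$ of $P$ the recursive calls $A(S,(p,q))$ with $p\neq q$ made on input $I_P$ form, with their quadrangles $pqsr$, exactly the tree $\mathcal Q$, and $$\rho(A,I_P)\;\le\; c\cdot\Big(n+\log\frac{n^n}{|\mathrm{OD}(P,\mathcal Q)|}\Big).$$ -/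

import Mathlib

namespace KMS

/-! ### Planar geometry -/

/-- Points of the plane. -/
abbrev Point : Type := ℝ × ℝ

/-- The cross product (determinant) of two plane vectors. -/
def cross (u v : Point) : ℝ := u.1 * v.2 - u.2 * v.1

/-- The orientation of the triple `(a, b, x)`: positive iff `x` lies strictly to the left of the
directed line from `a` to `b`.  If `a` is to the left of `b`, this means strictly above the
line `ab`. -/
def orient (a b x : Point) : ℝ := cross (b - a) (x - a)

/-- `a` is to the left of `b`.  Points with equal `x`-coordinates are compared by their
`y`-coordinates (lexicographic order). -/
abbrev LexLt (a b : Point) : Prop := a.1 < b.1 ∨ (a.1 = b.1 ∧ a.2 < b.2)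

/-- Reflexive version of `LexLt`. -/
abbrev LexLe (a b : Point) : Prop := a.1 < b.1 ∨ (a.1 = b.1 ∧ a.2 ≤ b.2)

/-- General position: no collinear triples (a `Finset` has no duplicates anyway). -/
def GeneralPosition (P : Finset Point) : Prop :=
  ∀ a ∈ P, ∀ b ∈ P, ∀ c ∈ P, a ≠ b → a ≠ c → b ≠ c → ¬ Collinear ℝ ({a, b, c} : Set Point)

open Classical in
/-- The convex hull vertices: the points of `P` on the boundary of the convex hull of `P`. -/
noncomputable def hullVertices (P : Finset Point) : Finset Point :=
  P.filter (fun x => x ∈ frontier (convexHull ℝ (P : Set Point)))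

/-! ### Quadrangle trees -/

/-- Binary trees whose nodes store the corners of a quadrangle: `node p q s r L R` has the
quadrangle `p, q, s, r` (in counterclockwise order) with root edge `pq`; `L` is the subtree at the
side `pr` and `R` the subtree at the side `qs`.  `nil` is the absent tree. -/
inductive QTree : Type
  | nil : QTree
  | node (p q s r : Point) (L R : QTree) : QTree

/-- The vertices of the piece of a convex polygon (with vertex set `V`) that lies on or to the left
of the directed line from `a` to `b`. -/
noncomputable def piece (V : Finset Point) (a b : Point) : Finset Point :=
  V.filter (fun v => 0 ≤ orient a b v)

/-- `IsQuadTree V p q T`: `T` is a quadrangle tree of the rooted convex polygon with vertex set `V`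
and root edge `pq`, where the polygon lies to the left of the directed line from `p` to `q`.
The polygon has the counterclockwise boundary `p, q, …, s, r, …`, and `sr` is an edge of it: all
vertices lie on one side of the line `sr`.  Only `r = p` and `s = q` are allowed as coincidences
of corners; a side that is degenerate in this way has no child.
The side `qs` is oriented as `(s, q)`, so that its piece lies to the left again. -/
def IsQuadTree : Finset Point → Point → Point → QTree → Prop
  | _, p, q, .nil => p = q
  | V, p, q, .node p' q' s r L R =>
      p ≠ q ∧ p' = p ∧ q' = q ∧ r ∈ V ∧ s ∈ V ∧ r ≠ s ∧ r ≠ q ∧ s ≠ p ∧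
      (∀ v ∈ V, 0 ≤ orient s r v) ∧
      IsQuadTree (piece V p r) p r L ∧ IsQuadTree (piece V s q) s q R

/-- `x` (a point of the given point set) belongs to the population of a node with quadrangle
`p, q, s, r`: it lies on or inside the quadrangle, but not on the line `pq`. -/
def InPopulation (p q s r x : Point) : Prop :=
  x ∈ convexHull ℝ ({p, q, s, r} : Set Point) ∧ orient p q x ≠ 0

/-- `x` belongs to the population of some node of the tree. -/
def InTree : QTree → Point → Prop
  | .nil, _ => False
  | .node p q s r L R, x => InPopulation p q s r x ∨ InTree L x ∨ InTree R x

/-- The order `x ≺ y` of a quadrangle tree: the node of `x` is a strict ancestor of the node of `y`,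
or both points belong to the same node and `y` is farther than `x` from the line through the root
edge `pq` of that node, on the side of the polygon. -/
def Prec : QTree → Point → Point → Prop
  | .nil, _, _ => False
  | .node p q s r L R, x, y =>
      (InPopulation p q s r x ∧ (InTree L y ∨ InTree R y)) ∨
      (InPopulation p q s r x ∧ InPopulation p q s r y ∧ orient p q x < orient p q y) ∨
      Prec L x y ∨ Prec R x y

/-- Ordered downdrafts of `(P, Q)`: a map from the points of `P` that are not hull vertices to `P`
that sends every point to a larger one in the order of `Q`, and a (strict) total order on each
fiber. -/
structure OrderedDowndraft (P : Finset Point) (Q : QTree) : Type where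
  map : {x : Point // x ∈ P ∧ x ∉ hullVertices P} → {x : Point // x ∈ P}
  prec_map : ∀ x, Prec Q x.1 (map x).1
  lt : ∀ y : {x : Point // x ∈ P}, {x // map x = y} → {x // map x = y} → Prop
  lt_total : ∀ y, IsStrictTotalOrder {x // map x = y} (lt y)

/-! ### Step counting

A computation returns a value together with the number of elementary steps it has made.
In the programs below every call of a function (so every pass through a loop or a recursion, and
every test on the coordinates of points) is charged one step by `tick`.  Apart from calls, the body
of each function performs a bounded number of operations on coordinates, machine integers and list
cells, so the count is the number of instructions up to a constant factor.
The programs look at points only by tests of bounded degree on a bounded number of points.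
All functions are total: recursions that are not structural carry a bound `fuel` on their depth,
which is no part of the computation and is always large enough for the calls that are made. -/

/-- A value together with the number of steps spent on computing it. -/
structure TimeM (α : Type) : Type where
  ret : α
  time : ℕ

instance : Monad TimeM where
  pure a := ⟨a, 0⟩
  bind m f := ⟨(f m.ret).ret, m.time + (f m.ret).time⟩

/-- One step. -/
def tick : TimeM Unit := ⟨(), 1⟩

/-! ### Tests on points -/

noncomputable def eqTest (a b : Point) : TimeM Bool := do
  tick
  return decide (a = b)

noncomputable def lexLtTest (a b : Point) : TimeM Bool := do
  tick
  return decide (LexLt a b)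

noncomputable def lexLeTest (a b : Point) : TimeM Bool := do
  tick
  return decide (LexLe a b)

/-- Is the slope of the pair `e` smaller than the slope of the pair `f`?  (Both pairs are given
from left to right; a vertical pair has slope `+∞`.) -/
noncomputable def slopeLtTest (e f : Point × Point) : TimeM Bool := do
  tick
  return decide (0 < cross (e.2 - e.1) (f.2 - f.1))

noncomputable def slopeLeTest (e f : Point × Point) : TimeM Bool := do
  tick
  return decide (0 ≤ cross (e.2 - e.1) (f.2 - f.1))

/-- Does `y` lie strictly above the line through `x` that is parallel to the pair `e`? -/
noncomputable def aboveTest (e : Point × Point) (x y : Point) : TimeM Bool := do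
  tick
  return decide (0 < cross (e.2 - e.1) (y - x))

/-- Does `x` lie on or above the line `ab`?  For `a = b` the line is understood to be the
point `a`, and nothing lies above it. -/
noncomputable def onOrAboveTest (a b x : Point) : TimeM Bool := do
  tick
  return decide (if a = b then x = a else 0 ≤ orient a b x)

/-! ### Lists -/

def len {α : Type} : List α → TimeM ℕ
  | [] => do
      tick
      return 0
  | _ :: xs => do
      tick
      let n ← len xs
      return n + 1

def filterList {α : Type} (f : α → TimeM Bool) : List α → TimeM (List α)
  | [] => do
      tick
      return []
  | x :: xs => do
      tick
      let b ← f x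
      let ys ← filterList f xs
      return if b then x :: ys else ys

/-- The `k`-th entry (counted from `0`). -/
def nth {α : Type} [Inhabited α] : List α → ℕ → TimeM α
  | [], _ => do
      tick
      return default
  | x :: _, 0 => do
      tick
      return x
  | _ :: xs, k + 1 => do
      tick
      nth xs k

/-! ### Selection in linear time (median of medians) -/

section Selection

variable {α : Type} [Inhabited α] (le : α → α → TimeM Bool)

def insertSorted (x : α) : List α → TimeM (List α)
  | [] => do
      tick
      return [x]
  | y :: ys => do
      tick
      let b ← le x y
      if b then
        return x :: y :: ys
      else do
        let zs ← insertSorted x ys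
        return y :: zs

/-- Insertion sort; it is only called on lists with at most five entries. -/
def sortSmall : List α → TimeM (List α)
  | [] => do
      tick
      return []
  | x :: xs => do
      tick
      let ys ← sortSmall xs
      insertSorted le x ys

/-- The medians of consecutive groups of five entries; an incomplete last group is ignored. -/
def medians : List α → TimeM (List α)
  | a :: b :: c :: d :: e :: xs => do
      tick
      let s ← sortSmall le [a, b, c, d, e]
      let m ← nth s 2
      let ms ← medians xs
      return m :: ms
  | _ => do
      tick
      return []

/-- The entries that are smaller than, equivalent to, and larger than the pivot. -/
def partition3 (pivot : α) : List α → TimeM (List α × List α × List α)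
  | [] => do
      tick
      return ([], [], [])
  | x :: xs => do
      tick
      let r ← partition3 pivot xs
      let b₁ ← le x pivot
      let b₂ ← le pivot x
      return if b₁ then
          (if b₂ then (r.1, x :: r.2.1, r.2.2) else (x :: r.1, r.2.1, r.2.2))
        else (r.1, r.2.1, x :: r.2.2)

/-- `select le fuel k xs` is the entry of rank `k` (counted from `0`) in the order `le`. -/
def select : ℕ → ℕ → List α → TimeM α
  | 0, _, _ => do
      tick
      return default
  | fuel + 1, k, xs => do
      tick
      let ms ← medians le xs
      match ms with
      | [] => do
          let s ← sortSmall le xs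
          nth s k
      | m :: ms' => do
          let l ← len (m :: ms')
          let pivot ← select fuel (l / 2) (m :: ms')
          let r ← partition3 le pivot xs
          let n₁ ← len r.1
          let n₂ ← len r.2.1
          if k < n₁ then
            select fuel k r.1
          else if k < n₁ + n₂ then
            return pivot
          else
            select fuel (k - n₁ - n₂) r.2.2

end Selection

/-! ### Bridge-finding (prune and search) -/

/-- Groups the points into pairs, each of them sorted from left to right, and at most one
remaining point. -/
noncomputable def pairUp : List Point → TimeM (List (Point × Point) × List Point)
  | a :: b :: xs => do
      tick
      let r ← pairUp xs
      let c ← lexLtTest a b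
      return ((if c then (a, b) else (b, a)) :: r.1, r.2)
  | xs => do
      tick
      return ([], xs)

/-- The leftmost and the rightmost point among those points of the list and of the current pair
`best` that are highest in the direction orthogonal to `e`. -/
noncomputable def support (e : Point × Point) :
    List Point → Point × Point → TimeM (Point × Point)
  | [], best => do
      tick
      return best
  | x :: xs, best => do
      tick
      let up ← aboveTest e best.1 x
      let down ← aboveTest e x best.1
      if up then
        support e xs (x, x)
      else if down then
        support e xs best
      else do
        let l ← lexLtTest x best.1
        let r ← lexLtTest best.2 x
        support e xs (if l then x else best.1, if r then x else best.2)

/-- Pruning when the slope of the bridge is smaller than that of `e`: of each pair that is at least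
as steep as `e`, only the right point is kept. -/
noncomputable def pruneSteep (e : Point × Point) :
    List (Point × Point) → List Point → TimeM (List Point)
  | [], rest => do
      tick
      return rest
  | f :: fs, rest => do
      tick
      let ys ← pruneSteep e fs rest
      let b ← slopeLtTest f e
      return if b then f.1 :: f.2 :: ys else f.2 :: ys

/-- Pruning when the slope of the bridge is larger than that of `e`: of each pair that is at most
as steep as `e`, only the left point is kept. -/
noncomputable def pruneFlat (e : Point × Point) :
    List (Point × Point) → List Point → TimeM (List Point)
  | [], rest => do
      tick
      return rest
  | f :: fs, rest => do
      tick
      let ys ← pruneFlat e fs rest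
      let b ← slopeLtTest e f
      return if b then f.1 :: f.2 :: ys else f.1 :: ys

/-- `bridge fuel S m` is the edge `(pᵢ, pⱼ)` of the upper convex hull of `S` that crosses the
vertical line through `m`: `pᵢ` is `m` or to the left of `m`, and `pⱼ` is to the right of `m`. -/
noncomputable def bridge : ℕ → List Point → Point → TimeM (Point × Point)
  | 0, _, _ => do
      tick
      return default
  | _ + 1, [], _ => do
      tick
      return default
  | _ + 1, [a], _ => do
      tick
      return (a, a)
  | _ + 1, [a, b], _ => do
      tick
      let c ← lexLtTest a b
      return if c then (a, b) else (b, a)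
  | fuel + 1, a :: b :: c :: S, m => do
      tick
      let pr ← pairUp (a :: b :: c :: S)
      let h ← len pr.1
      let e ← select slopeLeTest pr.1.length (h / 2) pr.1
      let t ← support e (b :: c :: S) (a, a)
      let mLeftOfTop ← lexLtTest m t.1
      let mLeftOfTop' ← lexLtTest m t.2
      if mLeftOfTop then do
        let S' ← pruneFlat e pr.1 pr.2
        bridge fuel S' m
      else if mLeftOfTop' then
        return t
      else do
        let S' ← pruneSteep e pr.1 pr.2
        bridge fuel S' m

/-! ### The Kirkpatrick–McQueen–Seidel algorithm -/

/-- The output: the hull list and the list of the internal points with the three corners of a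
witness triangle.  Both lists are written with the latest entry in front. -/
structure Output : Type where
  hull : List Point
  witness : List (Point × Point × Point × Point)

/-- Assigns to each point of `S*`, which lies in the quadrangle `pₗ pᵣ pⱼ pᵢ`, the one of the
triangles `pₗ pⱼ pᵢ` and `pₗ pᵣ pⱼ` that contains it. -/
noncomputable def giveWitness (pl pr pj pi : Point) : List Point → Output → TimeM Output
  | [], out => do
      tick
      return out
  | x :: xs, out => do
      tick
      let b ← onOrAboveTest pl pj x
      giveWitness pl pr pj pi xs
        ⟨out.hull, (if b then (x, pl, pj, pi) else (x, pl, pr, pj)) :: out.witness⟩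

/-- The recursive algorithm on the point set `S` with the edge `(pₗ, pᵣ)` of its convex hull.
It returns the binary tree of its recursive calls with `pₗ ≠ pᵣ`, each with its quadrangle, and the
output. -/
noncomputable def kms : ℕ → List Point → Point → Point → Output → TimeM (QTree × Output)
  | 0, _, _, _, out => do
      tick
      return (.nil, out)
  | fuel + 1, S, pl, pr, out => do
      tick
      let same ← eqTest pl pr
      if same then
        return (.nil, ⟨pl :: out.hull, out.witness⟩)
      else do
        let n ← len S
        let m ← select lexLeTest S.length ((n - 1) / 2) S
        let e ← bridge S.length S m
        let S₁ ← filterList (onOrAboveTest pl e.1) S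
        let S₂ ← filterList (onOrAboveTest e.2 pr) S
        let S₀ ← filterList (fun x => do
          let b₁ ← onOrAboveTest pl e.1 x
          let b₂ ← onOrAboveTest e.2 pr x
          return (!b₁ && !b₂)) S
        let r₁ ← kms fuel S₁ pl e.1 out
        let r₂ ← kms fuel S₂ e.2 pr r₁.2
        let out' ← giveWitness pl pr e.2 e.1 S₀ r₂.2
        return (.node pl pr e.2 e.1 r₁.1 r₂.1, out')

/-- The leftmost and the rightmost point of the list and of the current pair `best`. -/
noncomputable def extremes : List Point → Point × Point → TimeM (Point × Point)
  | [], best => do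
      tick
      return best
  | x :: xs, best => do
      tick
      let l ← lexLtTest x best.1
      let r ← lexLtTest best.2 x
      extremes xs (if l then x else best.1, if r then x else best.2)

/-- The whole algorithm on an input array. -/
noncomputable def run : List Point → TimeM (QTree × Output)
  | [] => do
      tick
      return (.nil, ⟨[], []⟩)
  | x :: xs => do
      tick
      let e ← extremes xs (x, x)
      kms (x :: xs).length (x :: xs) e.1 e.2 ⟨[], []⟩

end KMS

namespace KMS

/-! ### Running programs -/

/-! The cost of a call is linear in its point set: median-of-medians selection is linear, and each
pruning round of the bridge search discards a fixed fraction of the points. So the running time is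
`O(n + F)`, where `F` is the total size of the point sets of the calls with `p ≠ q` (`kms_spec`,
`run_spec`). It remains to bound `F` by `n + log (n ^ n / |OD|)`, up to a constant.

Let `A x` be the point set of the last call that contains `x`. These sets form a laminar family. The
left cap lies to the left of the median or at it, the right cap to the right of it, so a child gets
at most about half of the points of its parent; each level that a point survives lowers the
logarithm of the size of its set by at least `1/4`. Summation gives `∑ log |A x| + F / 4 ≤ n log n +
n / 4` (`KTree.exists_regions`).

On the other side, an internal point `x` can only be mapped into `A x`: what comes after it in the
order of the tree lies in the same call. Insert the internal points into their fibers by increasing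
`|A x|`. A new point goes to the front of the fiber of some `y ∈ A x`, or directly behind a point
inserted earlier, which lies in `A x` by laminarity. This leaves at most `2 |A x|` positions, so
`|OD| ≤ ∏ 2 |A x|` (`card_orderedDowndraft_le`). The two estimates together bound `F`
(`KTree.sum_card_le`).

The tree does not depend on the input order, because medians and bridges are unique in general
position (`KTree.unique`). The order from left to right is handled throughout by a tilted coordinate
`x + ε y`, which has no ties on `P` and makes no pair vertical. -/

@[simp] theorem ret_pure {α : Type} (a : α) : (pure a : TimeM α).ret = a := rfl

@[simp] theorem time_pure {α : Type} (a : α) : (pure a : TimeM α).time = 0 := rfl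

@[simp] theorem ret_bind {α β : Type} (x : TimeM α) (f : α → TimeM β) :
    (x >>= f).ret = (f x.ret).ret := rfl

@[simp] theorem time_bind {α β : Type} (x : TimeM α) (f : α → TimeM β) :
    (x >>= f).time = x.time + (f x.ret).time := rfl

@[simp] theorem time_tick : tick.time = 1 := rfl

/-! ### Lists -/

@[simp] theorem len_ret {α : Type} (l : List α) : (len l).ret = l.length := by
  induction l with
  | nil => simp [len]
  | cons x l ih => simp [len, ih]

@[simp] theorem len_time {α : Type} (l : List α) : (len l).time = l.length + 1 := by
  induction l with
  | nil => simp [len]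
  | cons x l ih => simp [len, ih]; omega

theorem filterList_ret {α : Type} (f : α → TimeM Bool) (l : List α) :
    (filterList f l).ret = l.filter (fun x => (f x).ret) := by
  induction l with
  | nil => simp [filterList]
  | cons x l ih => simp [filterList, ih, List.filter_cons]

theorem filterList_time_le {α : Type} (f : α → TimeM Bool) (k : ℕ) (hk : ∀ x, (f x).time ≤ k)
    (l : List α) : (filterList f l).time ≤ (k + 1) * l.length + 1 := by
  induction l with
  | nil => simp [filterList]
  | cons x l ih =>
    have := hk x
    simp only [filterList, time_bind, time_tick, time_pure, List.length_cons]
    nlinarith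

theorem nth_ret {α : Type} [Inhabited α] (l : List α) (k : ℕ) (h : k < l.length) :
    (nth l k).ret = l[k] := by
  induction l generalizing k with
  | nil => simp at h
  | cons x l ih =>
    cases k with
    | zero => simp [nth]
    | succ k => simpa [nth] using ih k (by simpa using h)

theorem nth_time_le {α : Type} [Inhabited α] (l : List α) (k : ℕ) :
    (nth l k).time ≤ l.length + 1 := by
  induction l generalizing k with
  | nil => simp [nth]
  | cons x l ih =>
    cases k with
    | zero => simp [nth]
    | succ k => have := ih k; simp [nth]; omega

/-! ### Selection -/

section

variable {α : Type} (le : α → α → TimeM Bool)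

theorem insertSorted_time_le (hle : ∀ x y, (le x y).time = 1) (x : α) (l : List α) :
    (insertSorted le x l).time ≤ 2 * l.length + 1 := by
  induction l with
  | nil => simp [insertSorted]
  | cons y l ih =>
    simp only [insertSorted, time_bind, time_tick, hle, List.length_cons]
    split <;> simp <;> omega

theorem insertSorted_perm (x : α) (l : List α) : (insertSorted le x l).ret.Perm (x :: l) := by
  induction l with
  | nil => simp [insertSorted]
  | cons y l ih =>
    simp only [insertSorted, ret_bind]
    split
    · simp
    · simpa using (ih.cons y).trans (List.Perm.swap x y l)

theorem sortSmall_time_le (hle : ∀ x y, (le x y).time = 1) (l : List α) :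
    (sortSmall le l).time ≤ (l.length + 1) ^ 2 ∧ (sortSmall le l).ret.length = l.length := by
  induction l with
  | nil => simp [sortSmall]
  | cons x l ih =>
    have h := insertSorted_time_le le hle x (sortSmall le l).ret
    have h' := (insertSorted_perm le x (sortSmall le l).ret).length_eq
    simp only [sortSmall, time_bind, time_tick, ret_bind, List.length_cons] at *
    constructor
    · nlinarith
    · omega

theorem sortSmall_perm (l : List α) : (sortSmall le l).ret.Perm l := by
  induction l with
  | nil => simp [sortSmall]
  | cons x l ih =>
    simp only [sortSmall, ret_bind]
    exact (insertSorted_perm le x _).trans (ih.cons x)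

variable (key : α → ℝ)

/-- On the entries of `l` the test `le` compares the values of `key`. -/
def ComparesBy (l : List α) : Prop :=
  ∀ x ∈ l, ∀ y ∈ l, (le x y).ret = decide (key x ≤ key y)

variable {le key}

theorem ComparesBy.mono {l l' : List α} (h : ComparesBy le key l) (hl : ∀ x ∈ l', x ∈ l) :
    ComparesBy le key l' :=
  fun x hx y hy => h x (hl x hx) y (hl y hy)

theorem insertSorted_sorted {x : α} {l : List α} (h : ComparesBy le key (x :: l))
    (hl : l.Pairwise (fun a b => key a ≤ key b)) :
    (insertSorted le x l).ret.Pairwise (fun a b => key a ≤ key b) := by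
  induction l with
  | nil => simp [insertSorted]
  | cons y l ih =>
    have hxy := h x (by simp) y (by simp)
    simp only [insertSorted, ret_bind, hxy]
    rw [List.pairwise_cons] at hl
    split
    · rename_i hc
      have hc : key x ≤ key y := by simpa using hc
      simp only [ret_pure, List.pairwise_cons]
      refine ⟨?_, hl⟩
      intro z hz
      rcases List.mem_cons.1 hz with rfl | hz
      · exact hc
      · exact hc.trans (hl.1 z hz)
    · rename_i hc
      have hc : key y < key x := by simpa using hc
      simp only [ret_bind, ret_pure, List.pairwise_cons]
      refine ⟨?_, ih (h.mono (by simp +contextual [or_imp])) hl.2⟩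
      intro z hz
      rcases List.mem_cons.1 ((insertSorted_perm le x l).mem_iff.1 hz) with rfl | hz
      · exact hc.le
      · exact hl.1 z hz

theorem sortSmall_sorted {l : List α} (h : ComparesBy le key l) :
    (sortSmall le l).ret.Pairwise (fun a b => key a ≤ key b) := by
  induction l with
  | nil => simp [sortSmall]
  | cons x l ih =>
    simp only [sortSmall, ret_bind]
    refine insertSorted_sorted (h.mono fun z hz => ?_) (ih (h.mono fun z hz => by simp [hz]))
    rcases List.mem_cons.1 hz with rfl | hz
    · simp
    · exact List.mem_cons_of_mem _ ((sortSmall_perm le l).mem_iff.1 hz)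

/-- `v` is an entry of `l` of rank `k` with respect to `key`. -/
def HasRank (key : α → ℝ) (l : List α) (k : ℕ) (v : α) : Prop :=
  v ∈ l ∧ l.countP (fun x => key x < key v) ≤ k ∧ k < l.countP (fun x => key x ≤ key v)

theorem HasRank.perm {l l' : List α} {k : ℕ} {v : α} (h : HasRank key l k v) (hl : l.Perm l') :
    HasRank key l' k v := by
  obtain ⟨h₁, h₂, h₃⟩ := h
  exact ⟨hl.mem_iff.1 h₁, by rwa [← hl.countP_eq], by rwa [← hl.countP_eq]⟩

theorem hasRank_getElem {l : List α} (hl : l.Pairwise (fun a b => key a ≤ key b)) {k : ℕ}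
    (hk : k < l.length) : HasRank key l k l[k] := by
  induction l generalizing k with
  | nil => simp at hk
  | cons x l ih =>
    rw [List.pairwise_cons] at hl
    cases k with
    | zero =>
      refine ⟨by simp, ?_, by simp⟩
      simp only [List.getElem_cons_zero, nonpos_iff_eq_zero, List.countP_eq_zero]
      intro z hz
      rcases List.mem_cons.1 hz with rfl | hz
      · simp
      · simpa using hl.1 z hz
    | succ k =>
      have hk' : k < l.length := by simpa using hk
      obtain ⟨h₁, h₂, h₃⟩ := ih hl.2 hk'
      have hx := hl.1 _ h₁
      refine ⟨by simp, ?_, ?_⟩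
      · simp only [List.getElem_cons_succ, List.countP_cons]
        split <;> omega
      · simp only [List.getElem_cons_succ, List.countP_cons, hx, decide_true, if_true]
        omega

/-! ### Partition around a pivot, medians of five, and linear-time selection -/

theorem partition3_time (hle : ∀ x y, (le x y).time = 1) (v : α) (l : List α) :
    (partition3 le v l).time = 3 * l.length + 1 := by
  induction l with
  | nil => simp [partition3]
  | cons x l ih => simp [partition3, ih, hle]; omega

theorem partition3_ret {v : α} {l l' : List α} (h : ComparesBy le key l') (hv : v ∈ l')
    (hl : ∀ x ∈ l, x ∈ l') :
    (partition3 le v l).ret = (l.filter (fun x => key x < key v),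
      l.filter (fun x => key x = key v), l.filter (fun x => key v < key x)) := by
  induction l with
  | nil => simp [partition3]
  | cons x l ih =>
    have e₁ := h x (hl x (by simp)) v hv
    have e₂ := h v hv x (hl x (by simp))
    simp only [partition3, ret_bind, ret_pure, e₁, e₂, ih fun z hz => hl z (by simp [hz])]
    rcases lt_trichotomy (key x) (key v) with hc | hc | hc
    · simp [hc.le, hc.not_ge, hc, hc.ne, hc.not_gt]
    · simp [hc]
    · simp [hc.not_ge, hc, hc.ne', hc.not_gt]

variable [Inhabited α]

theorem medians_time_le (hle : ∀ x y, (le x y).time = 1) :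
    ∀ l : List α, (medians le l).time ≤ 43 * l.length + 1
  | a :: b :: c :: d :: e :: xs => by
    have h₁ := sortSmall_time_le le hle [a, b, c, d, e]
    have h₂ := nth_time_le (sortSmall le [a, b, c, d, e]).ret 2
    have h₃ := medians_time_le hle xs
    rw [h₁.2] at h₂
    have h₁ := h₁.1
    simp only [medians, time_bind, time_tick, time_pure, List.length_cons, List.length_nil] at *
    omega
  | [] => by simp [medians]
  | [_] => by simp [medians]
  | [_, _] => by simp [medians]
  | [_, _, _] => by simp [medians]
  | [_, _, _, _] => by simp [medians]

theorem medians_length : ∀ l : List α, (medians le l).ret.length = l.length / 5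
  | a :: b :: c :: d :: e :: xs => by
    have h₃ := medians_length xs
    simp only [medians, ret_bind, ret_pure, List.length_cons] at *
    omega
  | [] => by simp [medians]
  | [_] => by simp [medians]
  | [_, _] => by simp [medians]
  | [_, _, _] => by simp [medians]
  | [_, _, _, _] => by simp [medians]

/-- In a sorted group of five, the median and the two entries on one side of it all satisfy any
one-sided bound that the median satisfies. So every median that counts stands for three entries of
the list. -/
theorem medians_spec : ∀ {l : List α}, ComparesBy le key l →
    (∀ x ∈ (medians le l).ret, x ∈ l) ∧
    (∀ t : ℝ, 3 * (medians le l).ret.countP (fun x => key x ≤ t) ≤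
      l.countP (fun x => key x ≤ t)) ∧
    (∀ t : ℝ, 3 * (medians le l).ret.countP (fun x => t ≤ key x) ≤
      l.countP (fun x => t ≤ key x))
  | a :: b :: c :: d :: e :: xs, h => by
    obtain ⟨h₁, h₂, h₃⟩ := medians_spec (l := xs) (h.mono (by simp +contextual))
    have hs := sortSmall_sorted (l := [a, b, c, d, e])
      (h.mono (by simp +contextual [or_imp]))
    have hp := sortSmall_perm le [a, b, c, d, e]
    have hlen := hp.length_eq
    obtain ⟨s, hs'⟩ : ∃ s, (sortSmall le [a, b, c, d, e]).ret = s := ⟨_, rfl⟩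
    have happ : ∀ p : α → Bool, (a :: b :: c :: d :: e :: xs).countP p =
        s.countP p + xs.countP p := by
      intro p
      rw [← hs', hp.countP_eq, ← List.countP_append]
      rfl
    simp only [medians, ret_bind, ret_pure, hs'] at *
    match s, hlen with
    | [u, v, w, y, z], _ =>
      have hw : (nth [u, v, w, y, z] 2).ret = w := rfl
      simp only [hw]
      simp only [List.pairwise_cons, List.mem_cons, List.not_mem_nil, or_false, forall_eq_or_imp,
        forall_eq] at hs
      obtain ⟨⟨_, huw, _⟩, ⟨hvw, _⟩, ⟨hwy, hwz⟩, _⟩ := hs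
      refine ⟨?_, ?_, ?_⟩
      · intro x hx
        rcases List.mem_cons.1 hx with rfl | hx
        · have : x ∈ [a, b, c, d, e] := hp.mem_iff.1 (by simp)
          simp only [List.mem_cons, List.not_mem_nil, or_false] at this ⊢
          tauto
        · simp [h₁ x hx]
      · intro t
        rw [happ]
        have := h₂ t
        by_cases hwt : key w ≤ t
        · have e₁ := huw.trans hwt
          have e₂ := hvw.trans hwt
          simp only [List.countP_cons, hwt, e₁, e₂, decide_true, if_true]
          omega
        · simp only [List.countP_cons, hwt, decide_false, Bool.false_eq_true, if_false]
          omega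
      · intro t
        rw [happ]
        have := h₃ t
        by_cases hwt : t ≤ key w
        · have e₁ := hwt.trans hwy
          have e₂ := hwt.trans hwz
          simp only [List.countP_cons, hwt, e₁, e₂, decide_true, if_true]
          omega
        · simp only [List.countP_cons, hwt, decide_false, Bool.false_eq_true, if_false]
          omega
  | [], _ => by simp [medians]
  | [_], _ => by simp [medians]
  | [_, _], _ => by simp [medians]
  | [_, _, _], _ => by simp [medians]
  | [_, _, _, _], _ => by simp [medians]

theorem select_spec {l : List α} (h : ComparesBy le key l) {fuel k : ℕ} (hf : l.length ≤ fuel)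
    (hk : k < l.length) : HasRank key l k (select le fuel k l).ret := by
  induction fuel generalizing k l with
  | zero => omega
  | succ fuel ih =>
    simp only [select, ret_bind]
    have hlen := medians_length (le := le) l
    obtain ⟨hmem, hlow, hhigh⟩ := medians_spec h
    match hms : (medians le l).ret with
    | [] =>
      have hp := sortSmall_perm le l
      have hk' : k < (sortSmall le l).ret.length := by rwa [hp.length_eq]
      simp only [ret_bind, nth_ret _ _ hk']
      exact (hasRank_getElem (sortSmall_sorted h) hk').perm hp
    | m :: ms =>
      rw [hms] at hmem hlow hhigh hlen
      simp only [ret_bind, len_ret]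
      have hlen0 : 0 < (m :: ms).length := by simp
      -- Correctness only needs the pivot to be an entry of the list; its rank matters for the
      -- running time alone.
      obtain ⟨hv, -, -⟩ := ih (l := m :: ms) (h.mono hmem) (by omega)
        (k := (m :: ms).length / 2) (by omega)
      obtain ⟨v, hvdef⟩ : ∃ v, (select le fuel ((m :: ms).length / 2) (m :: ms)).ret = v := ⟨_, rfl⟩
      rw [hvdef] at hv ⊢
      have hvl := hmem v hv
      rw [partition3_ret h hvl fun _ hx => hx]
      simp only
      have hlt : (l.filter (fun x => key x < key v)).length < l.length :=
        List.length_filter_lt_length_iff_exists.2 ⟨v, hvl, by simp⟩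
      have hgt : (l.filter (fun x => key v < key x)).length < l.length :=
        List.length_filter_lt_length_iff_exists.2 ⟨v, hvl, by simp⟩
      have hle_count : l.countP (fun x => key x ≤ key v) =
          (l.filter (fun x => key x < key v)).length +
            (l.filter (fun x => key x = key v)).length := by
        clear * -
        induction l with
        | nil => simp
        | cons x l ih =>
          rcases lt_trichotomy (key x) (key v) with hc | hc | hc
          · simp [hc.le, hc, hc.ne, ih]; omega
          · simp [hc, ih]; omega
          · simp [hc.not_ge, hc.ne', hc.not_gt, ih]
      have htotal : l.length = l.countP (fun x => key x ≤ key v) +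
          (l.filter (fun x => key v < key x)).length := by
        rw [← List.countP_eq_length_filter,
          l.length_eq_countP_add_countP (fun x => decide (key x ≤ key v))]
        simp
      split
      · rename_i hk₁
        obtain ⟨h₁, h₂, h₃⟩ := ih (l := l.filter (fun x => key x < key v))
          (h.mono fun x hx => (List.mem_filter.1 hx).1) (by omega) hk₁
        obtain ⟨w, hwdef⟩ : ∃ w, (select le fuel k (l.filter (fun x => key x < key v))).ret = w :=
          ⟨_, rfl⟩
        rw [hwdef] at h₁ h₂ h₃ ⊢
        obtain ⟨hw, hwv⟩ := List.mem_filter.1 h₁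
        have hwv : key w < key v := by simpa using hwv
        rw [List.countP_filter] at h₂ h₃
        refine ⟨hw, le_trans (List.countP_mono_left ?_) h₂,
          lt_of_lt_of_le h₃ (List.countP_mono_left ?_)⟩
        · intro x _ hx
          have hx : key x < key w := by simpa using hx
          simp [hx, hx.trans hwv]
        · intro x _ hx
          simp only [Bool.and_eq_true, decide_eq_true_eq] at hx ⊢
          exact hx.1
      · rename_i hk₁
        split
        · rename_i hk₂
          refine ⟨hvl, ?_, ?_⟩
          · rw [List.countP_eq_length_filter]; simp only [ret_pure]; omega
          · simp only [ret_pure]; omega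
        · rename_i hk₂
          have hk₃ : k - (l.filter (fun x => key x < key v)).length -
              (l.filter (fun x => key x = key v)).length <
              (l.filter (fun x => key v < key x)).length := by omega
          obtain ⟨h₁, h₂, h₃⟩ := ih (l := l.filter (fun x => key v < key x))
            (h.mono fun x hx => (List.mem_filter.1 hx).1) (by omega) hk₃
          obtain ⟨w, hwdef⟩ : ∃ w, (select le fuel (k - (l.filter (fun x => key x < key v)).length -
              (l.filter (fun x => key x = key v)).length)
              (l.filter (fun x => key v < key x))).ret = w := ⟨_, rfl⟩
          rw [hwdef] at h₁ h₂ h₃ ⊢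
          obtain ⟨hw, hwv⟩ := List.mem_filter.1 h₁
          have hwv : key v < key w := by simpa using hwv
          have hsplit : ∀ p : α → Bool, (∀ x, key x ≤ key v → p x = true) → l.countP p =
              l.countP (fun x => key x ≤ key v) +
                (l.filter (fun x => key v < key x)).countP p := by
            clear * -
            intro p hp
            induction l with
            | nil => simp
            | cons x l ih =>
              rcases le_or_gt (key x) (key v) with hc | hc
              · simp [hc, hc.not_gt, ih, hp x hc]; omega
              · simp only [hc, hc.not_ge, List.countP_cons, ih, decide_true, List.filter_cons_of_pos,
                  decide_false, Bool.false_eq_true, if_false]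
                omega
          refine ⟨hw, ?_, ?_⟩
          · rw [hsplit _ fun x hx => by simpa using lt_of_le_of_lt hx hwv]; omega
          · rw [hsplit _ fun x hx => by simpa using hx.trans hwv.le]; omega

/-- The pivot is a median of the `n / 5` group medians, so by `medians_spec` roughly `3n / 10`
entries are excluded from each side of the partition. The two recursive calls get about `n / 5` and
`7n / 10` entries, altogether a fixed fraction less than `n`; the constant `2000` leaves room for
rounding. -/
theorem select_time_le (hle : ∀ x y, (le x y).time = 1) {l : List α} (h : ComparesBy le key l)
    {fuel k : ℕ} (hf : l.length ≤ fuel) (hl : 0 < l.length) :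
    (select le fuel k l).time ≤ 2000 * l.length := by
  induction fuel generalizing k l with
  | zero => omega
  | succ fuel ih =>
    simp only [select, time_bind, time_tick]
    have hlen := medians_length (le := le) l
    have htime := medians_time_le (le := le) hle l
    obtain ⟨hmem, hlow, hhigh⟩ := medians_spec h
    match hms : (medians le l).ret with
    | [] =>
      rw [hms] at hlen
      have hs := sortSmall_time_le le hle l
      have hn := nth_time_le (sortSmall le l).ret k
      rw [hs.2] at hn
      have hl5 : l.length ≤ 4 := by simp at hlen; omega
      have : (l.length + 1) ^ 2 ≤ 25 := by nlinarith
      simp only [time_bind]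
      omega
    | m :: ms =>
      rw [hms] at hmem hlow hhigh hlen
      have hlen0 : 0 < (m :: ms).length := by simp
      have hcmp := h.mono hmem
      obtain ⟨hv, hv₁, hv₂⟩ := select_spec (l := m :: ms) hcmp (fuel := fuel) (by omega)
        (k := (m :: ms).length / 2) (by omega)
      have hrec := ih (k := (m :: ms).length / 2) hcmp (by omega) hlen0
      simp only [time_bind, len_ret, len_time, partition3_time hle]
      obtain ⟨v, hvdef⟩ : ∃ v, (select le fuel ((m :: ms).length / 2) (m :: ms)).ret = v := ⟨_, rfl⟩
      rw [hvdef] at hv hv₁ hv₂ ⊢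
      have hvl := hmem v hv
      rw [partition3_ret h hvl fun _ hx => hx]
      simp only
      have e₁ := (m :: ms).length_eq_countP_add_countP (fun x => decide (key x < key v))
      have e₂ := l.length_eq_countP_add_countP (fun x => decide (key x < key v))
      have e₃ := l.length_eq_countP_add_countP (fun x => decide (key x ≤ key v))
      have g₁ := hlow (key v)
      have g₂ := hhigh (key v)
      simp only [decide_eq_true_eq, not_lt, not_le] at e₁ e₂ e₃
      rw [List.countP_eq_length_filter (p := fun x => decide (key x < key v))] at e₂
      rw [List.countP_eq_length_filter (p := fun x => decide (key v < key x))] at e₃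
      have hmid := List.length_filter_le (fun x => decide (key x = key v)) l
      split
      · have := ih (k := k) (l := l.filter (fun x => key x < key v))
          (h.mono fun x hx => (List.mem_filter.1 hx).1) (by omega) (by omega)
        omega
      · split
        · simp only [time_pure]
          omega
        · by_cases hpos : 0 < (l.filter (fun x => key v < key x)).length
          · have := ih (k := k - (l.filter (fun x => key x < key v)).length -
                (l.filter (fun x => key x = key v)).length)
              (l := l.filter (fun x => key v < key x))
              (h.mono fun x hx => (List.mem_filter.1 hx).1) (by omega) hpos
            omega
          -- The rank `k` is not assumed to be in range, so the last recursive call may get an empty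
          -- list, which the induction hypothesis excludes.
          · have hnil : l.filter (fun x => key v < key x) = [] :=
              List.length_eq_zero_iff.1 (by omega)
            have : ∀ j, (select le fuel j ([] : List α)).time ≤ 10 := by
              intro j
              cases fuel <;> simp [select, medians, sortSmall, nth]
            rw [hnil]
            have := this (k - (l.filter (fun x => key x < key v)).length -
                (l.filter (fun x => key x = key v)).length)
            omega

end

/-! ### The tilted first coordinate -/

/-- A tilted first coordinate; for a suitable small `ε` its order on a finite point set is the
order from left to right. -/
def tilt (ε : ℝ) (x : Point) : ℝ := x.1 + ε * x.2

/-- On `S` the tilted coordinate realizes the order from left to right. -/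
def IsTilt (ε : ℝ) (S : Finset Point) : Prop :=
  ∀ a ∈ S, ∀ b ∈ S, LexLt a b ↔ tilt ε a < tilt ε b

/-- For a fixed pair of points every sufficiently small positive `ε` works: a difference of first
coordinates survives as `ε` tends to `0`, and for equal first coordinates `ε > 0` lets the second
ones decide. Finitely many pairs allow a common choice. -/
theorem exists_isTilt (S : Finset Point) : ∃ ε, IsTilt ε S := by
  have key : ∀ a b : Point, ∀ᶠ ε in nhdsWithin (0 : ℝ) (Set.Ioi 0),
      LexLt a b ↔ tilt ε a < tilt ε b := by
    intro a b
    have hc : ∀ x : Point, Filter.Tendsto (fun ε => tilt ε x) (nhdsWithin 0 (Set.Ioi 0))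
        (nhds x.1) := by
      intro x
      have : Continuous (fun ε => tilt ε x) := by unfold tilt; fun_prop
      simpa [tilt] using (this.tendsto 0).mono_left nhdsWithin_le_nhds
    rcases lt_trichotomy a.1 b.1 with h | h | h
    · filter_upwards [(hc a).eventually_lt (hc b) h] with ε hε
      simp [LexLt, h, hε]
    · filter_upwards [self_mem_nhdsWithin] with ε hε
      have hε : 0 < ε := hε
      simp [LexLt, tilt, h, hε]
    · filter_upwards [(hc b).eventually_lt (hc a) h] with ε hε
      simp [LexLt, h.not_gt, h.ne', hε.not_gt]
  have : ∀ᶠ ε in nhdsWithin (0 : ℝ) (Set.Ioi 0), IsTilt ε S := by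
    unfold IsTilt
    rw [Filter.eventually_all_finset]
    intro a _
    rw [Filter.eventually_all_finset]
    exact fun b _ => key a b
  exact this.exists

theorem IsTilt.mono {ε : ℝ} {S S' : Finset Point} (h : IsTilt ε S) (hS : S' ⊆ S) : IsTilt ε S' :=
  fun a ha b hb => h a (hS ha) b (hS hb)

theorem IsTilt.inj {ε : ℝ} {S : Finset Point} (h : IsTilt ε S) {a b : Point} (ha : a ∈ S)
    (hb : b ∈ S) (hab : tilt ε a = tilt ε b) : a = b := by
  have h₁ := (h a ha b hb).not.2 hab.not_lt
  have h₂ := (h b hb a ha).not.2 hab.not_gt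
  simp only [LexLt, not_or, not_and, not_lt] at h₁ h₂
  have e := le_antisymm h₂.1 h₁.1
  exact Prod.ext e (le_antisymm (h₂.2 e.symm) (h₁.2 e))

theorem IsTilt.lexLe_iff {ε : ℝ} {S : Finset Point} (h : IsTilt ε S) {a b : Point} (ha : a ∈ S)
    (hb : b ∈ S) : LexLe a b ↔ tilt ε a ≤ tilt ε b := by
  rw [← not_lt, ← h b hb a ha]
  simp only [LexLe, LexLt, not_or, not_and, not_lt]
  constructor
  · rintro (h | ⟨h, h'⟩)
    · exact ⟨h.le, fun e => absurd e h.ne'⟩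
    · exact ⟨h.le, fun _ => h'⟩
  · rintro ⟨h, h'⟩
    rcases h.lt_or_eq with h | h
    · exact Or.inl h
    · exact Or.inr ⟨h, h' h.symm⟩

theorem tilt_sub (ε : ℝ) (a b : Point) : tilt ε (a - b) = tilt ε a - tilt ε b := by
  simp [tilt]; ring

/-- For vectors that point to the right, a nonnegative `cross u v` says that `v` is at least as
steep as `u`; this is transitivity of that comparison. The middle vector must point strictly to the
right, since the identity is divided by `tilt ε v`. -/
theorem cross_trans {ε : ℝ} {u v w : Point} (hu : 0 ≤ tilt ε u) (hv : 0 < tilt ε v)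
    (hw : 0 ≤ tilt ε w) (huv : 0 ≤ cross u v) (hvw : 0 ≤ cross v w) : 0 ≤ cross u w := by
  have h : tilt ε v * cross u w = tilt ε w * cross u v + tilt ε u * cross v w := by
    simp only [tilt, cross]; ring
  have : 0 ≤ tilt ε v * cross u w := by rw [h]; positivity
  exact nonneg_of_mul_nonneg_right this hv

theorem cross_trans_lt {ε : ℝ} {u v w : Point} (hu : 0 ≤ tilt ε u) (hv : 0 < tilt ε v)
    (hw : 0 < tilt ε w) (huv : 0 < cross u v) (hvw : 0 ≤ cross v w) : 0 < cross u w := by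
  have h : tilt ε v * cross u w = tilt ε w * cross u v + tilt ε u * cross v w := by
    simp only [tilt, cross]; ring
  have : 0 < tilt ε v * cross u w := by rw [h]; positivity
  exact pos_of_mul_pos_right this hv.le

theorem cross_trans_lt' {ε : ℝ} {u v w : Point} (hu : 0 < tilt ε u) (hv : 0 < tilt ε v)
    (hw : 0 ≤ tilt ε w) (huv : 0 ≤ cross u v) (hvw : 0 < cross v w) : 0 < cross u w := by
  have h : tilt ε v * cross u w = tilt ε w * cross u v + tilt ε u * cross v w := by
    simp only [tilt, cross]; ring
  have : 0 < tilt ε v * cross u w := by rw [h]; positivity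
  exact pos_of_mul_pos_right this hv.le

theorem cross_swap (u v : Point) : cross v u = -cross u v := by
  simp only [cross]; ring

theorem cross_sub_right (u v w : Point) : cross u (v - w) = cross u v - cross u w := by
  simp only [cross, Prod.fst_sub, Prod.snd_sub]; ring

/-- The slope with respect to the tilted coordinate. -/
noncomputable def slope (ε : ℝ) (e : Point × Point) : ℝ := (e.2 - e.1).2 / tilt ε (e.2 - e.1)

/-- The shear from `(x, y)` to `(x + ε y, y)` has determinant `1`, so the cross product is the same
in tilted coordinates, where slopes are finite real numbers and can serve as keys for selection. -/
theorem slope_le_iff {ε : ℝ} {e f : Point × Point} (he : tilt ε e.1 < tilt ε e.2)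
    (hf : tilt ε f.1 < tilt ε f.2) :
    slope ε e ≤ slope ε f ↔ 0 ≤ cross (e.2 - e.1) (f.2 - f.1) := by
  have he : 0 < tilt ε (e.2 - e.1) := by rw [tilt_sub]; linarith
  have hf : 0 < tilt ε (f.2 - f.1) := by rw [tilt_sub]; linarith
  rw [slope, slope, div_le_div_iff₀ he hf, ← sub_nonneg]
  have : (f.2 - f.1).2 * tilt ε (e.2 - e.1) - (e.2 - e.1).2 * tilt ε (f.2 - f.1) =
      cross (e.2 - e.1) (f.2 - f.1) := by simp only [tilt, cross]; ring
  rw [this]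

theorem slope_lt_iff {ε : ℝ} {e f : Point × Point} (he : tilt ε e.1 < tilt ε e.2)
    (hf : tilt ε f.1 < tilt ε f.2) :
    slope ε e < slope ε f ↔ 0 < cross (e.2 - e.1) (f.2 - f.1) := by
  rw [← not_le, slope_le_iff hf he, cross_swap, neg_nonneg, not_le]

theorem orient_eq_cross (a b x : Point) : orient a b x = -cross (a - b) (x - b) := by
  simp only [orient, cross, Prod.fst_sub, Prod.snd_sub]; ring

theorem orient_swap (a b x : Point) : orient b a x = -orient a b x := by
  simp only [orient, cross, Prod.fst_sub, Prod.snd_sub]; ring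

theorem orient_rotate (a b c : Point) : orient b c a = orient a b c := by
  simp only [orient, cross, Prod.fst_sub, Prod.snd_sub]; ring

@[simp] theorem orient_self_left (a x : Point) : orient a a x = 0 := by simp [orient, cross]

@[simp] theorem orient_left (a b : Point) : orient a b a = 0 := by simp [orient, cross]

@[simp] theorem orient_right (a b : Point) : orient a b b = 0 := by simp [orient, cross, mul_comm]

/-! ### General position -/

theorem GeneralPosition.mono {S S' : Finset Point} (h : GeneralPosition S) (hS : S' ⊆ S) :
    GeneralPosition S' :=
  fun a ha b hb c hc => h a (hS ha) b (hS hb) c (hS hc)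

theorem collinear_of_orient_eq_zero {a b c : Point} (hab : a ≠ b) (h : orient a b c = 0) :
    Collinear ℝ ({a, b, c} : Set Point) := by
  rw [collinear_iff_of_mem (p₀ := a) (by simp)]
  refine ⟨b - a, ?_⟩
  have h' : (b.1 - a.1) * (c.2 - a.2) = (b.2 - a.2) * (c.1 - a.1) := by
    simp only [orient, cross, Prod.fst_sub, Prod.snd_sub] at h; linarith
  have hc : ∃ t : ℝ, c = t • (b - a) +ᵥ a := by
    by_cases h₁ : b.1 - a.1 = 0
    · have h₂ : b.2 - a.2 ≠ 0 := by
        intro h₂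
        exact hab (Prod.ext (by linarith) (by linarith))
      refine ⟨(c.2 - a.2) / (b.2 - a.2), Prod.ext ?_ ?_⟩
      · rw [h₁, zero_mul] at h'
        have := (mul_eq_zero.1 h'.symm).resolve_left h₂
        simp [h₁]; linarith
      · simp [div_mul_cancel₀ _ h₂]
    · refine ⟨(c.1 - a.1) / (b.1 - a.1), Prod.ext ?_ ?_⟩
      · simp [div_mul_cancel₀ _ h₁]
      · have : (c.1 - a.1) / (b.1 - a.1) * (b.2 - a.2) = c.2 - a.2 := by
          field_simp; linarith
        simp [this]
  intro x hx
  rcases hx with rfl | rfl | rfl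
  · exact ⟨0, by simp⟩
  · exact ⟨1, by simp⟩
  · exact hc

theorem GeneralPosition.orient_eq_zero {S : Finset Point} (h : GeneralPosition S) {a b c : Point}
    (ha : a ∈ S) (hb : b ∈ S) (hc : c ∈ S) (hab : a ≠ b) (h0 : orient a b c = 0) :
    c = a ∨ c = b := by
  by_contra! hne
  exact h a ha b hb c hc hab hne.1.symm hne.2.symm (collinear_of_orient_eq_zero hab h0)

/-! ### Bridges -/

/-- `rs` is the edge of the upper convex hull of `S` that crosses the vertical line through `m`. -/
def IsBridge (ε : ℝ) (S : Finset Point) (m r s : Point) : Prop :=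
  r ∈ S ∧ s ∈ S ∧ tilt ε r ≤ tilt ε m ∧ tilt ε m < tilt ε s ∧ ∀ x ∈ S, 0 ≤ orient s r x

/-- Two bridges cross a common vertical line between `m` and the next point, and neither line can
pass strictly below the end points of the other. Comparing slopes both ways makes the lines
parallel, hence equal; general position leaves only two points on the line, and their sides with
respect to `m` tell them apart. -/
theorem IsBridge.unique {ε : ℝ} {S : Finset Point} {m r s r' s' : Point} (hgp : GeneralPosition S)
    (h : IsBridge ε S m r s) (h' : IsBridge ε S m r' s') : r = r' ∧ s = s' := by
  obtain ⟨hr, hs, hrm, hms, hS⟩ := h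
  obtain ⟨hr', hs', hrm', hms', hS'⟩ := h'
  have hle : ∀ r s r' s' : Point, tilt ε r ≤ tilt ε m → tilt ε m < tilt ε s →
      tilt ε r' ≤ tilt ε m → tilt ε m < tilt ε s' → 0 ≤ orient s r s' → 0 ≤ orient s' r' r →
      0 ≤ cross (s' - r') (s - r) := by
    intro r s r' s' h₁ h₂ h₃ h₄ h₅ h₆
    have e₁ : 0 ≤ cross (s' - r') (s' - r) := by
      have : orient s' r' r = cross (s' - r') (s' - r) := by
        simp only [orient, cross, Prod.fst_sub, Prod.snd_sub]; ring
      rwa [← this]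
    have e₂ : 0 ≤ cross (s' - r) (s - r) := by
      rw [cross_swap, ← orient_eq_cross]; exact h₅
    refine cross_trans (ε := ε) ?_ ?_ ?_ e₁ e₂ <;> rw [tilt_sub] <;> linarith
  have hc := hle r s r' s' hrm hms hrm' hms' (hS s' hs') (hS' r hr)
  have hc' := hle r' s' r s hrm' hms' hrm hms (hS' s hs) (hS r' hr')
  have hc0 : cross (s' - r') (s - r) = 0 := by rw [cross_swap] at hc'; linarith
  have hne : s ≠ r := by rintro rfl; linarith
  have hne' : s' ≠ r' := by rintro rfl; linarith
  -- both lines are parallel, and each of them is above the other one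
  have hpar : ∀ x y : Point, cross (s' - r') (x - y) * tilt ε (s - r) =
      cross (s - r) (x - y) * tilt ε (s' - r') := by
    intro x y
    have : cross (s' - r') (x - y) * tilt ε (s - r) - cross (s - r) (x - y) * tilt ε (s' - r') =
        tilt ε (x - y) * cross (s' - r') (s - r) := by
      simp only [cross, tilt]; ring
    rw [hc0] at this
    linarith
  have t₁ : 0 < tilt ε (s - r) := by rw [tilt_sub]; linarith
  have t₂ : 0 < tilt ε (s' - r') := by rw [tilt_sub]; linarith
  have hx : ∀ x ∈ S, ∀ y, (y = r ∨ y = s) → ∀ z, (z = r' ∨ z = s') → x = z →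
      cross (s - r) (x - y) = 0 := by
    rintro x hx y hy z hz rfl
    have a₁ : cross (s - r) (x - y) ≤ 0 := by
      have := hS x hx
      rw [orient_eq_cross] at this
      have e : cross (s - r) (x - y) = cross (s - r) (x - r) := by
        rcases hy with rfl | rfl
        · rfl
        · simp only [cross, Prod.fst_sub, Prod.snd_sub]; ring
      linarith
    have a₂ : 0 ≤ cross (s' - r') (x - y) := by
      have hyS : y ∈ S := by rcases hy with rfl | rfl <;> assumption
      have := hS' y hyS
      rw [orient_eq_cross] at this
      have e : cross (s' - r') (x - y) = -cross (s' - r') (y - r') := by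
        rcases hz with rfl | rfl
        · simp only [cross, Prod.fst_sub, Prod.snd_sub]; ring
        · simp only [cross, Prod.fst_sub, Prod.snd_sub]; ring
      linarith
    have := hpar x y
    have b₁ : 0 ≤ cross (s' - r') (x - y) * tilt ε (s - r) := by positivity
    have b₂ := mul_nonpos_of_nonpos_of_nonneg a₁ t₂.le
    have b₃ : cross (s - r) (x - y) * tilt ε (s' - r') = 0 := by linarith
    exact (mul_eq_zero.1 b₃).resolve_right t₂.ne'
  have hrr := hx r' hr' r (Or.inl rfl) r' (Or.inl rfl) rfl
  have hss := hx s' hs' r (Or.inl rfl) s' (Or.inr rfl) rfl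
  have k₁ := hgp.orient_eq_zero hs hr hr' hne (by rw [orient_eq_cross, hrr, neg_zero])
  have k₂ := hgp.orient_eq_zero hs hr hs' hne (by rw [orient_eq_cross, hss, neg_zero])
  constructor
  · rcases k₁ with k | k
    · rw [k] at hrm'; linarith
    · exact k.symm
  · rcases k₂ with k | k
    · exact k.symm
    · rw [k] at hms'; linarith

/-- Among all pairs that straddle a vertical line just to the right of `m`, the one that crosses it
highest is the bridge: a point above its line could replace the end point on its own side and raise
the crossing. -/
theorem exists_isBridge {ε : ℝ} {S : Finset Point} {m z : Point} (hm : m ∈ S) (hz : z ∈ S)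
    (hmz : tilt ε m < tilt ε z) : ∃ r s, IsBridge ε S m r s := by
  classical
  obtain ⟨z, hz', hzmin⟩ := (S.filter (fun x => tilt ε m < tilt ε x)).exists_min_image (tilt ε)
    ⟨z, by simp [hz, hmz]⟩
  obtain ⟨hzS, hz⟩ := Finset.mem_filter.1 hz'
  -- As `z` is now the first point to the right of `m`, no point of `S` has tilted coordinate `c`.
  obtain ⟨c, hmc, hcz⟩ := exists_between hz
  have hc : ∀ x ∈ S, tilt ε x < c ∨ c < tilt ε x := by
    intro x hx
    rcases le_or_gt (tilt ε x) (tilt ε m) with h | h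
    · exact Or.inl (h.trans_lt hmc)
    · exact Or.inr (hcz.trans_le (hzmin x (by simp [hx, h])))
  let height : Point × Point → ℝ := fun e => e.1.2 + (c - tilt ε e.1) * slope ε e
  let E := (S ×ˢ S).filter (fun e => tilt ε e.1 < c ∧ c < tilt ε e.2)
  obtain ⟨⟨r, s⟩, hrs, hmax⟩ := E.exists_max_image height ⟨(m, z), by simp [E, hm, hzS, hmc, hcz]⟩
  simp only [E, Finset.mem_filter, Finset.mem_product] at hrs hmax
  obtain ⟨⟨hr, hs⟩, hrc, hcs⟩ := hrs
  have hheight : ∀ r s : Point, tilt ε r < c → c < tilt ε s →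
      height (r, s) * (tilt ε s - tilt ε r) =
        r.2 * (tilt ε s - c) + s.2 * (c - tilt ε r) := by
    intro r s h₁ h₂
    have : tilt ε s - tilt ε r ≠ 0 := by linarith
    simp only [height, slope, tilt_sub]
    field_simp
    simp only [Prod.snd_sub]
    ring
  have hrm : tilt ε r ≤ tilt ε m := by
    by_contra! h
    have := hzmin r (by simp [hr, h])
    linarith
  refine ⟨r, s, hr, hs, hrm, hmc.trans hcs, fun x hx => ?_⟩
  have e₀ := hheight r s hrc hcs
  rcases hc x hx with h | h
  · have e₁ := hheight x s h hcs
    have hm := hmax (x, s) ⟨⟨hx, hs⟩, h, hcs⟩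
    have e₂ : (s.2 * (c - tilt ε r) + r.2 * (tilt ε s - c)) * (tilt ε s - tilt ε x) -
        (s.2 * (c - tilt ε x) + x.2 * (tilt ε s - c)) * (tilt ε s - tilt ε r) =
        (tilt ε s - c) * orient s r x := by
      simp only [orient, cross, tilt, Prod.fst_sub, Prod.snd_sub]; ring
    have e₃ : 0 ≤ (tilt ε s - c) * orient s r x := by
      rw [← e₂, add_comm, ← e₀, add_comm (s.2 * _), ← e₁]
      have : 0 ≤ (height (r, s) - height (x, s)) * ((tilt ε s - tilt ε r) * (tilt ε s - tilt ε x)) :=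
        mul_nonneg (by linarith) (mul_nonneg (by linarith) (by linarith))
      linarith
    exact nonneg_of_mul_nonneg_right e₃ (by linarith)
  · have e₁ := hheight r x hrc h
    have hm := hmax (r, x) ⟨⟨hr, hx⟩, hrc, h⟩
    have e₂ : (r.2 * (tilt ε s - c) + s.2 * (c - tilt ε r)) * (tilt ε x - tilt ε r) -
        (r.2 * (tilt ε x - c) + x.2 * (c - tilt ε r)) * (tilt ε s - tilt ε r) =
        (c - tilt ε r) * orient s r x := by
      simp only [orient, cross, tilt, Prod.fst_sub, Prod.snd_sub]; ring
    have e₃ : 0 ≤ (c - tilt ε r) * orient s r x := by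
      rw [← e₂, ← e₀, ← e₁]
      have : 0 ≤ (height (r, s) - height (r, x)) * ((tilt ε s - tilt ε r) * (tilt ε x - tilt ε r)) :=
        mul_nonneg (by linarith) (mul_nonneg (by linarith) (by linarith))
      linarith
    exact nonneg_of_mul_nonneg_right e₃ (by linarith)

/-! ### Bridge-finding -/

theorem pairUp_time : ∀ l : List Point, (pairUp l).time = 2 * (l.length / 2) + 1
  | a :: b :: xs => by
    have := pairUp_time xs
    simp only [pairUp, time_bind, time_tick, this, lexLtTest, time_pure, List.length_cons]
    omega
  | [] => by simp [pairUp]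
  | [_] => by simp [pairUp]

/-- The points of a list of pairs. -/
def unpair (l : List (Point × Point)) : List Point := l.flatMap fun e => [e.1, e.2]

theorem unpair_length (l : List (Point × Point)) : (unpair l).length = 2 * l.length := by
  induction l with
  | nil => rfl
  | cons e l ih =>
    have : unpair (e :: l) = e.1 :: e.2 :: unpair l := rfl
    simp [this, ih]; omega

theorem pairUp_perm : ∀ l : List Point,
    (unpair (pairUp l).ret.1 ++ (pairUp l).ret.2).Perm l ∧ (pairUp l).ret.1.length = l.length / 2
  | a :: b :: xs => by
    obtain ⟨h, h'⟩ := pairUp_perm xs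
    simp only [pairUp, ret_bind, ret_pure, List.length_cons]
    refine ⟨?_, by omega⟩
    split
    · exact (h.cons b).cons a
    · exact ((h.cons a).cons b).trans (List.Perm.swap _ _ _)
  | [] => by simp [pairUp, unpair]
  | [_] => by simp [pairUp, unpair]

theorem pairUp_lt {ε : ℝ} {S : Finset Point} (hS : IsTilt ε S) : ∀ {l : List Point},
    (∀ x ∈ l, x ∈ S) → l.Nodup → ∀ e ∈ (pairUp l).ret.1, tilt ε e.1 < tilt ε e.2
  | a :: b :: xs, hl, hd => by
    have ih := pairUp_lt hS (l := xs) (fun x hx => hl x (by simp [hx]))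
      (by simp only [List.nodup_cons] at hd; exact hd.2.2)
    have ha := hl a (by simp)
    have hb := hl b (by simp)
    have hab : a ≠ b := by rintro rfl; simp at hd
    intro e he
    simp only [pairUp, ret_bind, ret_pure] at he
    rcases List.mem_cons.1 he with rfl | he
    · by_cases h : LexLt a b
      · simpa [lexLtTest, h] using (hS a ha b hb).1 h
      · have h₁ := (hS a ha b hb).not.1 h
        have h₂ := lt_of_le_of_ne (not_lt.1 h₁) fun e => hab (hS.inj ha hb e.symm)
        simpa [lexLtTest, h] using h₂
    · exact ih e he
  | [], _, _ => by simp [pairUp]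
  | [_], _, _ => by simp [pairUp]

theorem mem_unpair {l : List (Point × Point)} {x : Point} :
    x ∈ unpair l ↔ ∃ e ∈ l, x = e.1 ∨ x = e.2 := by
  simp [unpair]

/-! ### Highest points in a given direction -/

theorem support_time_le (e : Point × Point) (l : List Point) (best : Point × Point) :
    (support e l best).time ≤ 5 * l.length + 1 := by
  induction l generalizing best with
  | nil => simp [support]
  | cons x l ih =>
    simp only [support, time_bind, time_tick, aboveTest, lexLtTest, time_pure, ret_bind, ret_pure,
      List.length_cons]
    split
    · have := ih (x, x); omega
    · split
      · have := ih best; omega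
      · simp only [time_bind, time_tick, time_pure, ret_bind, ret_pure]
        have := ih (if (decide (LexLt x best.1)) = true then x else best.1,
          if (decide (LexLt best.2 x)) = true then x else best.2)
        omega

/-- `t` is the pair of the leftmost and the rightmost point among the points of `B` that are
highest in the direction orthogonal to `e`. -/
def IsSupport (ε : ℝ) (e : Point × Point) (B : Finset Point) (t : Point × Point) : Prop :=
  t.1 ∈ B ∧ t.2 ∈ B ∧ cross (e.2 - e.1) (t.2 - t.1) = 0 ∧
  ∀ x ∈ B, cross (e.2 - e.1) (x - t.1) ≤ 0 ∧
    (cross (e.2 - e.1) (x - t.1) = 0 → tilt ε t.1 ≤ tilt ε x ∧ tilt ε x ≤ tilt ε t.2)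

/-- `B` is the set of points scanned so far, and `best` is its support; this is the loop invariant.
-/
theorem support_spec {ε : ℝ} {S : Finset Point} (hS : IsTilt ε S) (e : Point × Point)
    {l : List Point} {B : Finset Point} {best : Point × Point} (hB : B ⊆ S)
    (hl : ∀ x ∈ l, x ∈ S) (h : IsSupport ε e B best) :
    IsSupport ε e (B ∪ l.toFinset) (support e l best).ret := by
  induction l generalizing B best with
  | nil => simpa [support] using h
  | cons x l ih =>
    have hx := hl x (by simp)
    have hl' : ∀ y ∈ l, y ∈ S := fun y hy => hl y (by simp [hy])
    have hB' : insert x B ⊆ S := Finset.insert_subset hx hB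
    have hun : B ∪ (x :: l).toFinset = insert x B ∪ l.toFinset := by
      ext; simp
    rw [hun]
    obtain ⟨h₁, h₂, h₃, h₄⟩ := h
    have hsub : ∀ y z w : Point, cross (e.2 - e.1) (y - z) =
        cross (e.2 - e.1) (y - w) + cross (e.2 - e.1) (w - z) := by
      intro y z w; simp only [cross, Prod.fst_sub, Prod.snd_sub]; ring
    have hself : ∀ y : Point, cross (e.2 - e.1) (y - y) = 0 := by intro y; simp [cross]
    have hneg : ∀ y z : Point, cross (e.2 - e.1) (y - z) = -cross (e.2 - e.1) (z - y) := by
      intro y z; simp only [cross, Prod.fst_sub, Prod.snd_sub]; ring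
    simp only [support, ret_bind, aboveTest, lexLtTest, ret_pure]
    split
    · rename_i hup
      have hup : 0 < cross (e.2 - e.1) (x - best.1) := by simpa using hup
      refine ih hB' hl' ⟨by simp, by simp, hself x, fun y hy => ?_⟩
      rcases Finset.mem_insert.1 hy with rfl | hy
      · exact ⟨(hself _).le, fun _ => ⟨le_rfl, le_rfl⟩⟩
      · have k := (h₄ y hy).1
        rw [hsub y x best.1, hneg best.1 x]
        exact ⟨by linarith, fun h => by linarith⟩
    · rename_i hup
      have hup : cross (e.2 - e.1) (x - best.1) ≤ 0 := by simpa using hup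
      split
      · rename_i hdown
        have hdown : 0 < cross (e.2 - e.1) (best.1 - x) := by simpa using hdown
        rw [hneg] at hdown
        refine ih hB' hl' ⟨by simp [h₁], by simp [h₂], h₃, fun y hy => ?_⟩
        rcases Finset.mem_insert.1 hy with rfl | hy
        · exact ⟨by linarith, fun h => by linarith⟩
        · exact h₄ y hy
      · rename_i hdown
        have hdown : cross (e.2 - e.1) (best.1 - x) ≤ 0 := by simpa using hdown
        rw [hneg] at hdown
        have hxb : cross (e.2 - e.1) (x - best.1) = 0 := by linarith
        simp only [ret_bind, ret_pure]
        have q₁ : ∃ l', l' = (if decide (LexLt x best.1) = true then x else best.1) ∧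
            (l' = x ∨ l' = best.1) ∧ tilt ε l' ≤ tilt ε x ∧ tilt ε l' ≤ tilt ε best.1 := by
          refine ⟨_, rfl, ?_⟩
          have := hS x hx best.1 (hB h₁)
          by_cases hc : LexLt x best.1
          · simp [hc, (this.1 hc).le]
          · simp [hc, not_lt.1 (this.not.1 hc)]
        have q₂ : ∃ r', r' = (if decide (LexLt best.2 x) = true then x else best.2) ∧
            (r' = x ∨ r' = best.2) ∧ tilt ε x ≤ tilt ε r' ∧ tilt ε best.2 ≤ tilt ε r' := by
          refine ⟨_, rfl, ?_⟩
          have := hS best.2 (hB h₂) x hx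
          by_cases hc : LexLt best.2 x
          · simp [hc, (this.1 hc).le]
          · simp [hc, not_lt.1 (this.not.1 hc)]
        obtain ⟨l', el, hl₁, hl₂, hl₃⟩ := q₁
        obtain ⟨r', er, hr₁, hr₂, hr₃⟩ := q₂
        rw [← el, ← er]
        have hl0 : cross (e.2 - e.1) (l' - best.1) = 0 := by
          rcases hl₁ with rfl | rfl
          · exact hxb
          · exact hself _
        have hr0 : cross (e.2 - e.1) (r' - best.1) = 0 := by
          rcases hr₁ with rfl | rfl
          · exact hxb
          · exact h₃
        refine ih hB' hl' ⟨?_, ?_, ?_, fun y hy => ?_⟩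
        · rcases hl₁ with rfl | rfl <;> simp [h₁]
        · rcases hr₁ with rfl | rfl <;> simp [h₂]
        · simp only
          rw [hsub _ _ best.1, hneg best.1, hl0, hr0]; simp
        · simp only
          rw [hsub _ _ best.1, hneg best.1 l', hl0, neg_zero, add_zero]
          rcases Finset.mem_insert.1 hy with rfl | hy
          · exact ⟨hxb.le, fun _ => ⟨hl₂, hr₂⟩⟩
          · obtain ⟨k₁, k₂⟩ := h₄ y hy
            exact ⟨k₁, fun h => ⟨hl₃.trans (k₂ h).1, (k₂ h).2.trans hr₃⟩⟩

/-! ### Pruning: its cost, its gain, and the points that survive -/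

theorem pruneSteep_time (e : Point × Point) (l : List (Point × Point)) (rest : List Point) :
    (pruneSteep e l rest).time = 2 * l.length + 1 := by
  induction l with
  | nil => simp [pruneSteep]
  | cons f l ih => simp [pruneSteep, ih, slopeLtTest]; omega

theorem pruneFlat_time (e : Point × Point) (l : List (Point × Point)) (rest : List Point) :
    (pruneFlat e l rest).time = 2 * l.length + 1 := by
  induction l with
  | nil => simp [pruneFlat]
  | cons f l ih => simp [pruneFlat, ih, slopeLtTest]; omega

theorem pruneSteep_sublist (e : Point × Point) (l : List (Point × Point)) (rest : List Point) :
    (pruneSteep e l rest).ret.Sublist (unpair l ++ rest) := by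
  induction l with
  | nil => simp [pruneSteep, unpair]
  | cons f l ih =>
    simp only [pruneSteep, ret_bind, ret_pure]
    split
    · exact (ih.cons_cons f.2).cons_cons f.1
    · exact (ih.cons_cons f.2).cons f.1

theorem pruneFlat_sublist (e : Point × Point) (l : List (Point × Point)) (rest : List Point) :
    (pruneFlat e l rest).ret.Sublist (unpair l ++ rest) := by
  induction l with
  | nil => simp [pruneFlat, unpair]
  | cons f l ih =>
    simp only [pruneFlat, ret_bind, ret_pure]
    split
    · exact (ih.cons_cons f.2).cons_cons f.1
    · exact (ih.cons f.2).cons_cons f.1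

theorem pruneSteep_length {ε : ℝ} {e : Point × Point} {l : List (Point × Point)}
    (rest : List Point) (he : tilt ε e.1 < tilt ε e.2) (hl : ∀ f ∈ l, tilt ε f.1 < tilt ε f.2) :
    (pruneSteep e l rest).ret.length =
      l.length + rest.length + l.countP (fun f => slope ε f < slope ε e) := by
  induction l with
  | nil => simp [pruneSteep]
  | cons f l ih =>
    have := ih fun g hg => hl g (by simp [hg])
    have hf := slope_lt_iff (hl f (by simp)) he
    simp only [pruneSteep, ret_bind, ret_pure, slopeLtTest]
    by_cases hc : slope ε f < slope ε e
    · simp [hc, hf.1 hc, this]; omega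
    · simp [hc, hf.not.1 hc, this]; omega

theorem pruneFlat_length {ε : ℝ} {e : Point × Point} {l : List (Point × Point)}
    (rest : List Point) (he : tilt ε e.1 < tilt ε e.2) (hl : ∀ f ∈ l, tilt ε f.1 < tilt ε f.2) :
    (pruneFlat e l rest).ret.length =
      l.length + rest.length + l.countP (fun f => slope ε e < slope ε f) := by
  induction l with
  | nil => simp [pruneFlat]
  | cons f l ih =>
    have := ih fun g hg => hl g (by simp [hg])
    have hf := slope_lt_iff he (hl f (by simp))
    simp only [pruneFlat, ret_bind, ret_pure, slopeLtTest]
    by_cases hc : slope ε e < slope ε f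
    · simp [hc, hf.1 hc, this]; omega
    · simp [hc, hf.not.1 hc, this]; omega

/-- Right points of pairs are always kept, so only an occurrence as a left point needs a condition
on the slope of its pair. -/
theorem mem_pruneSteep {e : Point × Point} {l : List (Point × Point)} {rest : List Point}
    {x : Point} (hx : x ∈ unpair l ++ rest)
    (h : ∀ f ∈ l, x = f.1 → 0 < cross (f.2 - f.1) (e.2 - e.1)) :
    x ∈ (pruneSteep e l rest).ret := by
  induction l with
  | nil => simpa [pruneSteep, unpair] using hx
  | cons f l ih =>
    have e' : unpair (f :: l) ++ rest = f.1 :: f.2 :: (unpair l ++ rest) := rfl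
    rw [e'] at hx
    have ih := fun hx' => ih hx' fun g hg => h g (by simp [hg])
    simp only [pruneSteep, ret_bind, ret_pure, slopeLtTest]
    rcases List.mem_cons.1 hx with hx | hx
    · simp [h f (by simp) hx, hx]
    · rcases List.mem_cons.1 hx with hx | hx
      · split <;> simp [hx]
      · have := ih hx
        split <;> simp [this]

theorem mem_pruneFlat {e : Point × Point} {l : List (Point × Point)} {rest : List Point}
    {x : Point} (hx : x ∈ unpair l ++ rest)
    (h : ∀ f ∈ l, x = f.2 → 0 < cross (e.2 - e.1) (f.2 - f.1)) :
    x ∈ (pruneFlat e l rest).ret := by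
  induction l with
  | nil => simpa [pruneFlat, unpair] using hx
  | cons f l ih =>
    have e' : unpair (f :: l) ++ rest = f.1 :: f.2 :: (unpair l ++ rest) := rfl
    rw [e'] at hx
    have ih := fun hx' => ih hx' fun g hg => h g (by simp [hg])
    simp only [pruneFlat, ret_bind, ret_pure, slopeLtTest]
    rcases List.mem_cons.1 hx with hx | hx
    · split <;> simp [hx]
    · rcases List.mem_cons.1 hx with hx | hx
      · simp [h f (by simp) hx, hx]
      · have := ih hx
        split <;> simp [this]

theorem comparesBy_slope {ε : ℝ} {l : List (Point × Point)}
    (hl : ∀ f ∈ l, tilt ε f.1 < tilt ε f.2) : ComparesBy slopeLeTest (slope ε) l := by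
  intro e he f hf
  simp only [slopeLeTest, ret_bind, ret_pure]
  exact decide_eq_decide.2 (slope_le_iff (hl e he) (hl f hf)).symm

theorem comparesBy_tilt {ε : ℝ} {S : Finset Point} (hS : IsTilt ε S) {l : List Point}
    (hl : ∀ x ∈ l, x ∈ S) : ComparesBy lexLeTest (tilt ε) l := by
  intro e he f hf
  simp only [lexLeTest, ret_bind, ret_pure]
  exact decide_eq_decide.2 (hS.lexLe_iff (hl e he) (hl f hf))

theorem lexLtTest_ret {ε : ℝ} {S : Finset Point} (hS : IsTilt ε S) {a b : Point} (ha : a ∈ S)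
    (hb : b ∈ S) : (lexLtTest a b).ret = decide (tilt ε a < tilt ε b) := by
  simp only [lexLtTest, ret_bind, ret_pure]
  exact decide_eq_decide.2 (hS a ha b hb)

theorem IsBridge.mono {ε : ℝ} {S S' : Finset Point} {m r s : Point} (h : IsBridge ε S m r s)
    (hS : S' ⊆ S) (hr : r ∈ S') (hs : s ∈ S') : IsBridge ε S' m r s :=
  ⟨hr, hs, h.2.2.1, h.2.2.2.1, fun x hx => h.2.2.2.2 x (hS hx)⟩

/-- If the highest points in the direction orthogonal to `e` are to the right of `m`, the bridge
over `m` is steeper than `e`. -/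
theorem IsBridge.slope_gt {ε : ℝ} {S : Finset Point} {m r s : Point} {e t : Point × Point}
    (h : IsBridge ε S m r s) (he : tilt ε e.1 < tilt ε e.2) (ht : IsSupport ε e S t)
    (hm : tilt ε m < tilt ε t.1) : 0 < cross (e.2 - e.1) (s - r) := by
  obtain ⟨hr, hs, hrm, hms, hS⟩ := h
  obtain ⟨ht₁, -, -, ht⟩ := ht
  obtain ⟨k₁, k₂⟩ := ht r hr
  have k : cross (e.2 - e.1) (r - t.1) < 0 :=
    lt_of_le_of_ne k₁ fun h => by linarith [(k₂ h).1]
  -- Since `r` is to the left of the leftmost highest point `t.1`, it is strictly lower, so the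
  -- vector from `r` to `t.1` is steeper than `e`. The bridge is at least as steep as this vector,
  -- as `t.1` is not above it.
  refine cross_trans_lt (ε := ε) (v := t.1 - r) ?_ ?_ ?_ ?_ ?_
  · rw [tilt_sub]; linarith
  · rw [tilt_sub]; linarith
  · rw [tilt_sub]; linarith
  · rw [cross_sub_right] at k ⊢; linarith
  · have := hS _ ht₁
    rwa [orient_eq_cross, ← cross_swap] at this

/-- Mirror image of `IsBridge.slope_gt`: now `s` is to the right of the rightmost highest point
`t.2`, hence strictly lower, and the bridge is at most as steep as the vector from `t.2` to `s`. -/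
theorem IsBridge.slope_lt {ε : ℝ} {S : Finset Point} {m r s : Point} {e t : Point × Point}
    (h : IsBridge ε S m r s) (he : tilt ε e.1 < tilt ε e.2) (ht : IsSupport ε e S t)
    (hm : tilt ε t.2 ≤ tilt ε m) : 0 < cross (s - r) (e.2 - e.1) := by
  obtain ⟨hr, hs, hrm, hms, hS⟩ := h
  obtain ⟨-, ht₂, ht₀, ht⟩ := ht
  obtain ⟨k₁, k₂⟩ := ht s hs
  have k : cross (e.2 - e.1) (s - t.1) < 0 :=
    lt_of_le_of_ne k₁ fun h => by linarith [(k₂ h).2]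
  refine cross_trans_lt' (ε := ε) (v := s - t.2) ?_ ?_ ?_ ?_ ?_
  · rw [tilt_sub]; linarith
  · rw [tilt_sub]; linarith
  · rw [tilt_sub]; linarith
  · have := hS _ ht₂
    have e' : cross (s - r) (s - t.2) = -cross (s - r) (t.2 - r) := by
      simp only [cross, Prod.fst_sub, Prod.snd_sub]; ring
    rwa [e', ← orient_eq_cross]
  · rw [cross_swap]
    simp only [cross_sub_right] at k ht₀ ⊢; linarith

/-- A pair that is at most as steep as `e` does not end on a steeper bridge. -/
theorem IsBridge.pair_of_slope_gt {ε : ℝ} {S : Finset Point} {m r s : Point} {e f : Point × Point}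
    (h : IsBridge ε S m r s) (he : tilt ε e.1 < tilt ε e.2) (hf : tilt ε f.1 < tilt ε f.2)
    (hfS : f.1 ∈ S) (hrs : 0 < cross (e.2 - e.1) (s - r)) (hx : r = f.2 ∨ s = f.2) :
    0 < cross (e.2 - e.1) (f.2 - f.1) := by
  obtain ⟨hr, hs, hrm, hms, hS⟩ := h
  -- The bridge line passes through `f.2`, and `f.1` is not above it, so `f` is at least as steep as
  -- the bridge, which is steeper than `e`.
  refine cross_trans_lt (ε := ε) (v := s - r) ?_ ?_ ?_ hrs ?_
  · rw [tilt_sub]; linarith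
  · rw [tilt_sub]; linarith
  · rw [tilt_sub]; linarith
  · have := hS _ hfS
    rw [orient_eq_cross] at this
    rcases hx with h | h <;> rw [← h]
    · simp only [cross_sub_right] at this ⊢; linarith
    · have e' : cross (s - r) (s - f.1) = -cross (s - r) (f.1 - r) := by
        simp only [cross, Prod.fst_sub, Prod.snd_sub]; ring
      rwa [e']

theorem IsBridge.pair_of_slope_lt {ε : ℝ} {S : Finset Point} {m r s : Point} {e f : Point × Point}
    (h : IsBridge ε S m r s) (he : tilt ε e.1 < tilt ε e.2) (hf : tilt ε f.1 < tilt ε f.2)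
    (hfS : f.2 ∈ S) (hrs : 0 < cross (s - r) (e.2 - e.1)) (hx : r = f.1 ∨ s = f.1) :
    0 < cross (f.2 - f.1) (e.2 - e.1) := by
  obtain ⟨hr, hs, hrm, hms, hS⟩ := h
  refine cross_trans_lt' (ε := ε) (v := s - r) ?_ ?_ ?_ ?_ hrs
  · rw [tilt_sub]; linarith
  · rw [tilt_sub]; linarith
  · rw [tilt_sub]; linarith
  · have := hS _ hfS
    rw [orient_eq_cross] at this
    rcases hx with h | h <;> rw [← h]
    · rwa [cross_swap]
    · have e' : cross (f.2 - s) (s - r) = -cross (s - r) (f.2 - r) := by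
        simp only [cross, Prod.fst_sub, Prod.snd_sub]; ring
      rwa [e']

/-- The highest points span a line parallel to `e` with all of `S` on or below it. If they lie on
both sides of `m`, they form a bridge themselves, and bridges are unique. -/
theorem IsBridge.eq_of_isSupport {ε : ℝ} {S : Finset Point} {m r s : Point} {e t : Point × Point}
    (hgp : GeneralPosition S) (h : IsBridge ε S m r s) (he : tilt ε e.1 < tilt ε e.2)
    (ht : IsSupport ε e S t) (h₁ : tilt ε t.1 ≤ tilt ε m) (h₂ : tilt ε m < tilt ε t.2) :
    t = (r, s) := by
  obtain ⟨ht₁, ht₂, ht₀, ht⟩ := ht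
  have : IsBridge ε S m t.1 t.2 := by
    refine ⟨ht₁, ht₂, h₁, h₂, fun x hx => ?_⟩
    have k := (ht x hx).1
    have t₁ : 0 < tilt ε (e.2 - e.1) := by rw [tilt_sub]; linarith
    have t₂ : 0 < tilt ε (t.2 - t.1) := by rw [tilt_sub]; linarith
    have e' : cross (t.2 - t.1) (x - t.1) * tilt ε (e.2 - e.1) =
        cross (e.2 - e.1) (x - t.1) * tilt ε (t.2 - t.1) -
          cross (e.2 - e.1) (t.2 - t.1) * tilt ε (x - t.1) := by
      simp only [cross, tilt]; ring
    rw [ht₀, zero_mul, sub_zero] at e'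
    have k' : cross (t.2 - t.1) (x - t.1) * tilt ε (e.2 - e.1) ≤ 0 := by
      rw [e']; exact mul_nonpos_of_nonpos_of_nonneg k t₂.le
    rw [orient_eq_cross, neg_nonneg]
    exact nonpos_of_mul_nonpos_left k' t₁
  obtain ⟨e₁, e₂⟩ := this.unique hgp h
  exact Prod.ext e₁ e₂

/-- With `e` of median slope, pruning removes one point from at least half of the pairs, so about a
quarter of the points, and the linear costs of the rounds sum up geometrically. The point `m` is
only required to be in `P`, because pruning may discard it. -/
theorem bridge_spec {ε : ℝ} {P : Finset Point} (hgp : GeneralPosition P) (hP : IsTilt ε P)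
    {m r s : Point} (hm : m ∈ P) {fuel : ℕ} {l : List Point} (hl : ∀ x ∈ l, x ∈ P)
    (hd : l.Nodup) (h : IsBridge ε l.toFinset m r s) (hf : l.length ≤ fuel) :
    (bridge fuel l m).ret = (r, s) ∧ (bridge fuel l m).time ≤ 30000 * l.length := by
  induction fuel generalizing l with
  | zero =>
    have : l = [] := List.length_eq_zero_iff.1 (by omega)
    subst this
    simpa using h.1
  | succ fuel ih =>
    have hrs : tilt ε r < tilt ε s := h.2.2.1.trans_lt h.2.2.2.1
    match l, hl, hd, h, hf with
    | [], _, _, h, _ => simpa using h.1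
    | [a], _, _, h, _ =>
      have h₁ := h.1
      have h₂ := h.2.1
      simp only [List.toFinset_cons, List.toFinset_nil, insert_empty_eq, Finset.mem_singleton]
        at h₁ h₂
      rw [h₁, h₂] at hrs
      exact absurd hrs (lt_irrefl _)
    | [a, b], hl, _, h, _ =>
      have h₁ := h.1
      have h₂ := h.2.1
      simp only [List.toFinset_cons, List.toFinset_nil, insert_empty_eq, Finset.mem_insert,
        Finset.mem_singleton] at h₁ h₂
      simp only [bridge, ret_bind, lexLtTest_ret hP (hl a (by simp)) (hl b (by simp)), time_bind,
        time_tick, ret_pure, time_pure]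
      refine ⟨?_, by simp [lexLtTest]⟩
      rcases h₁ with rfl | rfl <;> rcases h₂ with rfl | rfl
      · exact absurd hrs (lt_irrefl _)
      · simp [hrs]
      · simp [hrs.not_gt]
      · exact absurd hrs (lt_irrefl _)
    | a :: b :: c :: S, hl, hd, h, hf =>
      obtain ⟨l, hldef⟩ : ∃ l, l = a :: b :: c :: S := ⟨_, rfl⟩
      have hl3 : 3 ≤ l.length := by simp [hldef]
      have hrest : (b :: c :: S).length = l.length - 1 := by simp [hldef]
      have hset : {a} ∪ (b :: c :: S).toFinset = l.toFinset := by
        rw [hldef]; ext; simp; tauto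
      have hgp' : GeneralPosition l.toFinset :=
        hgp.mono fun x hx => hl x (by rw [← hldef]; simpa using hx)
      have ha := hl a (by simp)
      have hb : ∀ x ∈ b :: c :: S, x ∈ P := fun x hx => hl x (by
        rw [List.mem_cons]; exact Or.inr hx)
      simp only [bridge]
      rw [← hldef] at hl hd h hf ⊢
      simp only [ret_bind, time_bind, time_tick, len_ret, len_time]
      obtain ⟨hperm, hplen⟩ := pairUp_perm l
      have hplt := pairUp_lt hP hl hd
      have hptime := pairUp_time l
      obtain ⟨⟨F, rest⟩, hFr⟩ : ∃ F, (pairUp l).ret = F := ⟨_, rfl⟩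
      rw [hFr] at hperm hplen hplt ⊢
      simp only at hperm hplen hplt ⊢
      have hcmp := comparesBy_slope hplt
      have hk : F.length / 2 < F.length := by omega
      obtain ⟨heF, he₁, he₂⟩ := select_spec hcmp le_rfl hk
      have hetime := select_time_le (le := slopeLeTest)
        (fun x y => by simp [slopeLeTest]) hcmp (k := F.length / 2) le_rfl (by omega)
      obtain ⟨e, hedef⟩ : ∃ e, (select slopeLeTest F.length (F.length / 2) F).ret = e := ⟨_, rfl⟩
      rw [hedef] at heF he₁ he₂ ⊢
      have he := hplt e heF
      have hsupp := support_spec (ε := ε) hP e (l := b :: c :: S) (B := {a}) (best := (a, a))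
        (by simpa using ha) hb (by simp [IsSupport, cross])
      have hstime := support_time_le e (b :: c :: S) (a, a)
      rw [hset] at hsupp
      obtain ⟨t, htdef⟩ : ∃ t, (support e (b :: c :: S) (a, a)).ret = t := ⟨_, rfl⟩
      rw [htdef] at hsupp ⊢
      have ht₁ := hl _ (List.mem_toFinset.1 hsupp.1)
      have ht₂ := hl _ (List.mem_toFinset.1 hsupp.2.1)
      rw [lexLtTest_ret hP hm ht₁, lexLtTest_ret hP hm ht₂]
      have hlt : ∀ x y, (lexLtTest x y).time = 1 := fun x y => by simp [lexLtTest]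
      simp only [hlt]
      have hFlen : l.length = 2 * F.length + rest.length := by
        rw [← hperm.length_eq, List.length_append, unpair_length]
      have hFmem : ∀ f ∈ F, f.1 ∈ l.toFinset ∧ f.2 ∈ l.toFinset := by
        intro f hf
        simp only [List.mem_toFinset, ← hperm.mem_iff, List.mem_append, mem_unpair]
        exact ⟨Or.inl ⟨f, hf, Or.inl rfl⟩, Or.inl ⟨f, hf, Or.inr rfl⟩⟩
      have hrmem : r ∈ unpair F ++ rest := by rw [hperm.mem_iff]; simpa using h.1
      have hsmem : s ∈ unpair F ++ rest := by rw [hperm.mem_iff]; simpa using h.2.1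
      -- A sublist that retains `r` and `s` still has `rs` as its bridge. The length bound says that
      -- at least half of the pairs lose a point, which pays for this round.
      have hnext : ∀ l' : List Point, l'.Sublist (unpair F ++ rest) → r ∈ l' → s ∈ l' →
          l'.length + (F.length - F.length / 2) ≤ l.length →
          (bridge fuel l' m).ret = (r, s) ∧ (bridge fuel l' m).time ≤ 30000 * l'.length := by
        intro l' hl' hr hs hlen
        have hsub : ∀ x ∈ l', x ∈ l := fun x hx => hperm.mem_iff.1 (hl'.subset hx)
        refine ih (fun x hx => hl x (hsub x hx)) (hl'.nodup (hperm.nodup_iff.2 hd)) ?_ (by omega)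
        refine h.mono ?_ (by simpa using hr) (by simpa using hs)
        intro x hx
        simpa using hsub x (by simpa using hx)
      split
      · rename_i hc
        have hc : tilt ε m < tilt ε t.1 := by simpa using hc
        have hgt := h.slope_gt he hsupp hc
        have hlen := pruneFlat_length rest he hplt
        have hcount := F.length_eq_countP_add_countP (fun f => decide (slope ε f ≤ slope ε e))
        simp only [decide_eq_true_eq, not_le] at hcount
        obtain ⟨k₁, k₂⟩ := hnext _ (pruneFlat_sublist e F rest)
          (mem_pruneFlat hrmem fun f hf hx => h.pair_of_slope_gt he (hplt f hf) (hFmem f hf).1 hgt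
            (Or.inl hx))
          (mem_pruneFlat hsmem fun f hf hx => h.pair_of_slope_gt he (hplt f hf) (hFmem f hf).1 hgt
            (Or.inr hx)) (by omega)
        have := pruneFlat_time e F rest
        refine ⟨by simpa using k₁, ?_⟩
        simp only [time_bind]
        omega
      · rename_i hc
        have hc : tilt ε t.1 ≤ tilt ε m := by simpa using hc
        split
        · rename_i hc'
          have hc' : tilt ε m < tilt ε t.2 := by simpa using hc'
          refine ⟨by simpa using h.eq_of_isSupport hgp' he hsupp hc hc', ?_⟩
          simp only [time_pure]
          omega
        · rename_i hc'
          have hc' : tilt ε t.2 ≤ tilt ε m := by simpa using hc'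
          have hgt := h.slope_lt he hsupp hc'
          have hlen := pruneSteep_length rest he hplt
          obtain ⟨k₁, k₂⟩ := hnext _ (pruneSteep_sublist e F rest)
            (mem_pruneSteep hrmem fun f hf hx => h.pair_of_slope_lt he (hplt f hf) (hFmem f hf).2
              hgt (Or.inl hx))
            (mem_pruneSteep hsmem fun f hf hx => h.pair_of_slope_lt he (hplt f hf) (hFmem f hf).2
              hgt (Or.inr hx)) (by omega)
          have := pruneSteep_time e F rest
          refine ⟨by simpa using k₁, ?_⟩
          simp only [time_bind]
          omega

/-! ### Caps of the upper hull -/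

/-- `S` lies between `p` and `q`, and on or above the line `pq`. -/
structure Rooted (ε : ℝ) (S : Finset Point) (p q : Point) : Prop where
  gp : GeneralPosition S
  isTilt : IsTilt ε S
  left_mem : p ∈ S
  right_mem : q ∈ S
  left_le : ∀ x ∈ S, tilt ε p ≤ tilt ε x
  le_right : ∀ x ∈ S, tilt ε x ≤ tilt ε q
  above : ∀ x ∈ S, 0 ≤ orient p q x

/-- `rs` is an edge of the upper convex hull of `S`. -/
def IsUpperEdge (ε : ℝ) (S : Finset Point) (r s : Point) : Prop :=
  r ∈ S ∧ s ∈ S ∧ tilt ε r < tilt ε s ∧ ∀ x ∈ S, 0 ≤ orient s r x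

theorem IsBridge.isUpperEdge {ε : ℝ} {S : Finset Point} {m r s : Point}
    (h : IsBridge ε S m r s) : IsUpperEdge ε S r s :=
  ⟨h.1, h.2.1, h.2.2.1.trans_lt h.2.2.2.1, h.2.2.2.2⟩

open Classical in
/-- The points of `S` on or above the line `ab` (just `a` if `a = b`). -/
noncomputable def cap (S : Finset Point) (a b : Point) : Finset Point :=
  S.filter (fun x => if a = b then x = a else 0 ≤ orient a b x)

theorem mem_cap {S : Finset Point} {a b x : Point} :
    x ∈ cap S a b ↔ x ∈ S ∧ (if a = b then x = a else 0 ≤ orient a b x) := by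
  simp [cap]

theorem mem_cap_of_ne {S : Finset Point} {a b x : Point} (h : a ≠ b) :
    x ∈ cap S a b ↔ x ∈ S ∧ 0 ≤ orient a b x := by
  simp [cap, h]

theorem cap_subset (S : Finset Point) (a b : Point) : cap S a b ⊆ S := Finset.filter_subset _ _

theorem left_mem_cap {S : Finset Point} {a b : Point} (ha : a ∈ S) : a ∈ cap S a b := by
  simp [mem_cap, ha]

theorem right_mem_cap {S : Finset Point} {a b : Point} (hb : b ∈ S) : b ∈ cap S a b := by
  rw [mem_cap]
  split
  · rename_i h; exact ⟨hb, h.symm⟩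
  · simp [hb]

theorem cap_self {S : Finset Point} {a : Point} (ha : a ∈ S) : cap S a a = {a} := by
  ext x
  simp only [mem_cap, if_true, Finset.mem_singleton]
  exact ⟨fun h => h.2, fun h => ⟨h ▸ ha, h⟩⟩

section Caps

variable {ε : ℝ} {S : Finset Point} {p q r s x : Point}

/-- The upper boundary is concave: `p` and `x` are not above the line `rs`, so a point `x` to the
right of `r` is not above the line `pr` either, and in general position it is strictly below.
Disjointness and halving of the caps both rest on this. -/
theorem Rooted.le_of_mem_left_cap (h : Rooted ε S p q) (he : IsUpperEdge ε S r s)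
    (hx : x ∈ cap S p r) : tilt ε x ≤ tilt ε r := by
  obtain ⟨hr, hs, hrs, hS⟩ := he
  rw [mem_cap] at hx
  obtain ⟨hxS, hx⟩ := hx
  split at hx
  · rename_i hpr; rw [hx, hpr]
  · rename_i hpr
    by_contra! hlt
    have hpr' : tilt ε p < tilt ε r :=
      lt_of_le_of_ne (h.left_le r hr) fun e => hpr (h.isTilt.inj h.left_mem hr e)
    have h₁ : 0 ≤ cross (s - r) (r - p) := by
      have := hS p h.left_mem
      rw [orient_eq_cross] at this
      simp only [cross_sub_right] at this ⊢; linarith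
    have h₂ : 0 ≤ cross (x - r) (s - r) := by
      have := hS x hxS
      rwa [orient_eq_cross, ← cross_swap] at this
    have h₃ : 0 ≤ cross (x - r) (r - p) := by
      refine cross_trans (ε := ε) (v := s - r) ?_ ?_ ?_ h₂ h₁ <;> rw [tilt_sub] <;> linarith
    have h₄ : cross (x - r) (r - p) = -orient p r x := by
      simp only [orient, cross, Prod.fst_sub, Prod.snd_sub]; ring
    rcases h.gp.orient_eq_zero h.left_mem hr hxS hpr (by linarith) with rfl | rfl <;> linarith

theorem Rooted.le_of_mem_right_cap (h : Rooted ε S p q) (he : IsUpperEdge ε S r s)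
    (hx : x ∈ cap S s q) : tilt ε s ≤ tilt ε x := by
  obtain ⟨hr, hs, hrs, hS⟩ := he
  rw [mem_cap] at hx
  obtain ⟨hxS, hx⟩ := hx
  split at hx
  · rw [hx]
  · rename_i hsq
    by_contra! hlt
    have hsq' : tilt ε s < tilt ε q :=
      lt_of_le_of_ne (h.le_right s hs) fun e => hsq (h.isTilt.inj hs h.right_mem e)
    have h₁ : 0 ≤ cross (q - s) (s - r) := by
      have := hS q h.right_mem
      have e' : orient s r q = cross (q - s) (s - r) := by
        simp only [orient, cross, Prod.fst_sub, Prod.snd_sub]; ring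
      rwa [e'] at this
    have h₂ : 0 ≤ cross (s - r) (s - x) := by
      have := hS x hxS
      have e' : orient s r x = cross (s - r) (s - x) := by
        simp only [orient, cross, Prod.fst_sub, Prod.snd_sub]; ring
      rwa [e'] at this
    have h₃ : 0 ≤ cross (q - s) (s - x) := by
      refine cross_trans (ε := ε) (v := s - r) ?_ ?_ ?_ h₁ h₂ <;> rw [tilt_sub] <;> linarith
    have h₄ : cross (q - s) (s - x) = -orient s q x := by
      simp only [orient, cross, Prod.fst_sub, Prod.snd_sub]; ring
    rcases h.gp.orient_eq_zero hs h.right_mem hxS hsq (by linarith) with rfl | rfl <;> linarith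

theorem Rooted.left_cap (h : Rooted ε S p q) (he : IsUpperEdge ε S r s) :
    Rooted ε (cap S p r) p r where
  gp := h.gp.mono (cap_subset _ _ _)
  isTilt := h.isTilt.mono (cap_subset _ _ _)
  left_mem := left_mem_cap h.left_mem
  right_mem := right_mem_cap he.1
  left_le x hx := h.left_le x (cap_subset _ _ _ hx)
  le_right _ hx := h.le_of_mem_left_cap he hx
  above x hx := by
    rw [mem_cap] at hx
    split at hx
    · rename_i e; simp [← e]
    · exact hx.2

theorem Rooted.right_cap (h : Rooted ε S p q) (he : IsUpperEdge ε S r s) :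
    Rooted ε (cap S s q) s q where
  gp := h.gp.mono (cap_subset _ _ _)
  isTilt := h.isTilt.mono (cap_subset _ _ _)
  left_mem := left_mem_cap he.2.1
  right_mem := right_mem_cap h.right_mem
  left_le _ hx := h.le_of_mem_right_cap he hx
  le_right x hx := h.le_right x (cap_subset _ _ _ hx)
  above x hx := by
    rw [mem_cap] at hx
    split at hx
    · rename_i e; simp [← e]
    · exact hx.2

theorem Rooted.disjoint_caps (h : Rooted ε S p q) (he : IsUpperEdge ε S r s) :
    Disjoint (cap S p r) (cap S s q) := by
  rw [Finset.disjoint_left]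
  intro x h₁ h₂
  have := h.le_of_mem_left_cap he h₁
  have := h.le_of_mem_right_cap he h₂
  have := he.2.2.1
  linarith

/-- The points outside of the cap are below the line `ij` as well. Those that are not to the right
of `r` lie below the segment `pr`, whose ends are not above `ij`; those to the right of `r` follow
by concavity, through the decreasing slopes of `ij`, `ir`, `rs` and `rx`. -/
theorem Rooted.isUpperEdge_of_left_cap (h : Rooted ε S p q) (he : IsUpperEdge ε S r s)
    {i j : Point} (hij : IsUpperEdge ε (cap S p r) i j) : IsUpperEdge ε S i j := by
  obtain ⟨hi, hj, hlt, hcap⟩ := hij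
  refine ⟨cap_subset _ _ _ hi, cap_subset _ _ _ hj, hlt, fun x hx => ?_⟩
  have hpi := h.left_le i (cap_subset _ _ _ hi)
  have hjr := h.le_of_mem_left_cap he hj
  have hpr : p ≠ r := by rintro rfl; linarith
  by_cases hxc : x ∈ cap S p r
  · exact hcap x hxc
  · have hxo : orient p r x < 0 := by
      rw [mem_cap_of_ne hpr] at hxc; push Not at hxc; exact hxc hx
    have hr := hcap r (right_mem_cap he.1)
    rcases le_or_gt (tilt ε x) (tilt ε r) with hxr | hxr
    · have hp := hcap p (left_mem_cap h.left_mem)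
      have hpx := h.left_le x hx
      -- Interpolation between the values of `orient j i` at `p` and `r`; the last term accounts for
      -- the distance of `x` below `pr`.
      have e : (tilt ε r - tilt ε p) * orient j i x = (tilt ε r - tilt ε x) * orient j i p +
          (tilt ε x - tilt ε p) * orient j i r + (tilt ε j - tilt ε i) * -orient p r x := by
        simp only [orient, cross, tilt, Prod.fst_sub, Prod.snd_sub]; ring
      have : 0 ≤ (tilt ε r - tilt ε p) * orient j i x := by
        rw [e]
        have := mul_nonneg (sub_nonneg.2 hxr) hp
        have := mul_nonneg (sub_nonneg.2 hpx) hr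
        have := mul_nonneg (sub_nonneg.2 hlt.le) (neg_nonneg.2 hxo.le)
        linarith
      exact nonneg_of_mul_nonneg_right this (by linarith)
    · have hrs := he.2.2.1
      have h₁ : 0 ≤ cross (x - r) (s - r) := by
        have := he.2.2.2 x hx
        rwa [orient_eq_cross, ← cross_swap] at this
      have h₂ : 0 ≤ cross (s - r) (r - i) := by
        have := he.2.2.2 i (cap_subset _ _ _ hi)
        rw [orient_eq_cross] at this
        simp only [cross_sub_right] at this ⊢; linarith
      have h₃ : 0 ≤ cross (r - i) (j - i) := by
        rwa [orient_eq_cross, ← cross_swap] at hr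
      have h₄ : 0 ≤ cross (x - r) (r - i) := by
        refine cross_trans (ε := ε) (v := s - r) ?_ ?_ ?_ h₁ h₂ <;> rw [tilt_sub] <;> linarith
      have h₅ : 0 ≤ cross (x - r) (j - i) := by
        refine cross_trans (ε := ε) (v := r - i) ?_ ?_ ?_ h₄ h₃ <;> rw [tilt_sub] <;> linarith
      have e : orient j i x = cross (x - r) (j - i) + cross (r - i) (j - i) := by
        simp only [orient, cross, Prod.fst_sub, Prod.snd_sub]; ring
      linarith

theorem Rooted.isUpperEdge_of_right_cap (h : Rooted ε S p q) (he : IsUpperEdge ε S r s)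
    {i j : Point} (hij : IsUpperEdge ε (cap S s q) i j) : IsUpperEdge ε S i j := by
  obtain ⟨hi, hj, hlt, hcap⟩ := hij
  refine ⟨cap_subset _ _ _ hi, cap_subset _ _ _ hj, hlt, fun x hx => ?_⟩
  have hjq := h.le_right j (cap_subset _ _ _ hj)
  have hsi := h.le_of_mem_right_cap he hi
  have hsq : s ≠ q := by rintro rfl; linarith
  by_cases hxc : x ∈ cap S s q
  · exact hcap x hxc
  · have hxo : orient s q x < 0 := by
      rw [mem_cap_of_ne hsq] at hxc; push Not at hxc; exact hxc hx
    have hs := hcap s (left_mem_cap he.2.1)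
    rcases le_or_gt (tilt ε s) (tilt ε x) with hxs | hxs
    · have hq := hcap q (right_mem_cap h.right_mem)
      have hxq := h.le_right x hx
      have e : (tilt ε q - tilt ε s) * orient j i x = (tilt ε q - tilt ε x) * orient j i s +
          (tilt ε x - tilt ε s) * orient j i q + (tilt ε j - tilt ε i) * -orient s q x := by
        simp only [orient, cross, tilt, Prod.fst_sub, Prod.snd_sub]; ring
      have : 0 ≤ (tilt ε q - tilt ε s) * orient j i x := by
        rw [e]
        have := mul_nonneg (sub_nonneg.2 hxq) hs
        have := mul_nonneg (sub_nonneg.2 hxs) hq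
        have := mul_nonneg (sub_nonneg.2 hlt.le) (neg_nonneg.2 hxo.le)
        linarith
      exact nonneg_of_mul_nonneg_right this (by linarith)
    · have hrs := he.2.2.1
      have h₁ : 0 ≤ cross (s - r) (s - x) := by
        have := he.2.2.2 x hx
        have e' : orient s r x = cross (s - r) (s - x) := by
          simp only [orient, cross, Prod.fst_sub, Prod.snd_sub]; ring
        rwa [e'] at this
      have h₂ : 0 ≤ cross (j - s) (s - r) := by
        have := he.2.2.2 j (cap_subset _ _ _ hj)
        have e' : orient s r j = cross (j - s) (s - r) := by
          simp only [orient, cross, Prod.fst_sub, Prod.snd_sub]; ring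
        rwa [e'] at this
      have h₃ : 0 ≤ cross (j - i) (j - s) := by
        have e' : orient j i s = cross (j - i) (j - s) := by
          simp only [orient, cross, Prod.fst_sub, Prod.snd_sub]; ring
        rwa [e'] at hs
      have h₄ : 0 ≤ cross (j - s) (s - x) := by
        refine cross_trans (ε := ε) (v := s - r) ?_ ?_ ?_ h₂ h₁ <;> rw [tilt_sub] <;> linarith
      have h₅ : 0 ≤ cross (j - i) (s - x) := by
        refine cross_trans (ε := ε) (v := j - s) ?_ ?_ ?_ h₃ h₄ <;> rw [tilt_sub] <;> linarith
      have e : orient j i x = cross (j - i) (s - x) + cross (j - i) (j - s) := by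
        simp only [orient, cross, Prod.fst_sub, Prod.snd_sub]; ring
      linarith

/-! ### Convex hulls, quadrangles and hull vertices -/

theorem mem_convexHull_triangle {a b c x : Point} {C : Set Point} (hC : Convex ℝ C) (ha : a ∈ C)
    (hb : b ∈ C) (hc : c ∈ C) (h : 0 < orient a b c) (h₁ : 0 ≤ orient a b x)
    (h₂ : 0 ≤ orient b c x) (h₃ : 0 ≤ orient c a x) : x ∈ C := by
  have hsum : orient b c x + orient c a x + orient a b x = orient a b c := by
    simp only [orient, cross, Prod.fst_sub, Prod.snd_sub]; ring
  -- Barycentric coordinates as ratios of signed areas.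
  have hx : x = ∑ i : Fin 3, (![orient b c x / orient a b c, orient c a x / orient a b c,
      orient a b x / orient a b c] : Fin 3 → ℝ) i • (![a, b, c] : Fin 3 → Point) i := by
    rw [Fin.sum_univ_three]
    refine Prod.ext ?_ ?_
    · simp only [Matrix.cons_val, Prod.fst_add, Prod.smul_fst, smul_eq_mul]
      field_simp
      simp only [orient, cross, Prod.fst_sub, Prod.snd_sub]; ring
    · simp only [Matrix.cons_val, Prod.snd_add, Prod.smul_snd, smul_eq_mul]
      field_simp
      simp only [orient, cross, Prod.fst_sub, Prod.snd_sub]; ring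
  rw [hx]
  refine hC.sum_mem ?_ ?_ ?_
  · intro i _
    fin_cases i
    · exact div_nonneg h₂ h.le
    · exact div_nonneg h₃ h.le
    · exact div_nonneg h₁ h.le
  · rw [Fin.sum_univ_three]
    simp only [Matrix.cons_val]
    rw [← add_div, ← add_div, hsum, div_self h.ne']
  · intro i _
    fin_cases i <;> assumption

/-- A point outside of both caps lies in the quadrangle, and it is not the farthest point of the
quadrangle from its root edge. -/
theorem Rooted.quadrangle (h : Rooted ε S p q) (hpq : p ≠ q) (he : IsUpperEdge ε S r s)
    (hx : x ∈ S) (hx₁ : x ∉ cap S p r) (hx₂ : x ∉ cap S s q) :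
    x ∈ convexHull ℝ ({p, q, s, r} : Set Point) ∧ 0 < orient p q x ∧
      (orient p q x < orient p q r ∨ orient p q x < orient p q s) := by
  obtain ⟨hr, hs, hrs, hS⟩ := he
  have hsub := subset_convexHull ℝ ({p, q, s, r} : Set Point)
  have hC := convex_convexHull ℝ ({p, q, s, r} : Set Point)
  have pC := hsub (show p ∈ ({p, q, s, r} : Set Point) by simp)
  have qC := hsub (show q ∈ ({p, q, s, r} : Set Point) by simp)
  have sC := hsub (show s ∈ ({p, q, s, r} : Set Point) by simp)
  have rC := hsub (show r ∈ ({p, q, s, r} : Set Point) by simp)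
  have hxp : x ≠ p := by rintro rfl; exact hx₁ (left_mem_cap hx)
  have hxr : x ≠ r := by rintro rfl; exact hx₁ (right_mem_cap hx)
  have hxs : x ≠ s := by rintro rfl; exact hx₂ (left_mem_cap hx)
  have hxq : x ≠ q := by rintro rfl; exact hx₂ (right_mem_cap hx)
  have hps : p ≠ s := by rintro rfl; linarith [h.left_le r hr]
  have hsr : s ≠ r := by rintro rfl; linarith
  have hpos : 0 < orient p q x := lt_of_le_of_ne (h.above x hx) fun e => by
    rcases h.gp.orient_eq_zero h.left_mem h.right_mem hx hpq e.symm with e | e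
    exacts [hxp e, hxq e]
  have hsrx : 0 < orient s r x := lt_of_le_of_ne (hS x hx) fun e => by
    rcases h.gp.orient_eq_zero hs hr hx hsr e.symm with e | e
    exacts [hxs e, hxr e]
  -- The diagonal `ps` cuts the quadrangle into the triangles `psr` and `pqs`, and `x` lies in one
  -- of them.
  rcases le_or_gt 0 (orient p s x) with hc | hc
  · have hpr : p ≠ r := by
      rintro rfl
      rw [orient_swap] at hsrx
      linarith
    have hprx : orient p r x < 0 := by
      rw [mem_cap_of_ne hpr] at hx₁; push Not at hx₁; exact hx₁ hx
    have hD : 0 < orient p s r := by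
      have h0 := hS p h.left_mem
      rw [orient_rotate] at h0
      refine lt_of_le_of_ne h0 fun e => ?_
      rcases h.gp.orient_eq_zero h.left_mem hs hr hps e.symm with e | e
      exacts [hpr e.symm, hsr e.symm]
    have hrpx : 0 ≤ orient r p x := by rw [orient_swap]; linarith
    refine ⟨mem_convexHull_triangle hC pC sC rC hD hc hsrx.le hrpx, hpos, ?_⟩
    -- The height of `x` over `pq` is the barycentric mean of those of `s`, `r` and `p`. The last
    -- one is `0` and has positive weight, so `r` and `s` cannot both be at most as high as `x`.
    by_contra! hcon
    have e₁ : orient p s r * orient p q x =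
        orient r p x * orient p q s + orient p s x * orient p q r := by
      simp only [orient, cross, Prod.fst_sub, Prod.snd_sub]; ring
    have e₂ : orient p s r = orient p s x + orient s r x + orient r p x := by
      simp only [orient, cross, Prod.fst_sub, Prod.snd_sub]; ring
    have := mul_le_mul_of_nonneg_left hcon.1 hc
    have := mul_le_mul_of_nonneg_left hcon.2 hrpx
    have := mul_pos hsrx hpos
    rw [e₂] at e₁
    linarith
  · have hpsx : 0 < orient s p x := by rw [orient_swap]; linarith
    have hsq : s ≠ q := by rintro rfl; linarith
    have hqsx : 0 < orient q s x := by
      rw [mem_cap_of_ne hsq] at hx₂; push Not at hx₂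
      rw [orient_swap]; linarith [hx₂ hx]
    have e₂ : orient p q s = orient p q x + orient q s x + orient s p x := by
      simp only [orient, cross, Prod.fst_sub, Prod.snd_sub]; ring
    exact ⟨mem_convexHull_triangle hC pC qC sC (by linarith) hpos.le hqsx.le hpsx.le, hpos,
      Or.inr (by linarith)⟩

theorem convexHull_subset_orient_nonneg {a b : Point} {C : Set Point}
    (h : ∀ x ∈ C, 0 ≤ orient a b x) : ∀ x ∈ convexHull ℝ C, 0 ≤ orient a b x := by
  have hconv : Convex ℝ {x : Point | 0 ≤ orient a b x} := by
    intro x hx y hy α β hα hβ hαβ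
    have e : orient a b (α • x + β • y) = α * orient a b x + β * orient a b y := by
      obtain rfl : α = 1 - β := by linarith
      simp only [orient, cross, Prod.fst_sub, Prod.snd_sub, Prod.fst_add, Prod.snd_add,
        Prod.smul_fst, Prod.smul_snd, smul_eq_mul]; ring
    simp only [Set.mem_ofPred_eq] at hx hy ⊢
    rw [e]; positivity
  exact fun x hx => convexHull_min (fun y hy => h y hy) hconv hx

/-- The end points of an edge of the convex hull are hull vertices. -/
theorem mem_hullVertices {a b x : Point} (hab : a ≠ b) (hx : x ∈ S) (h0 : orient a b x = 0)
    (h : ∀ y ∈ S, 0 ≤ orient a b y) : x ∈ hullVertices S := by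
  simp only [hullVertices, Finset.mem_filter, hx, true_and]
  refine ⟨subset_closure (subset_convexHull ℝ _ hx), fun hint => ?_⟩
  have hsub := convexHull_subset_orient_nonneg (C := (S : Set Point)) h
  -- The outer normal of the edge: a step from `x` along `n` leaves the half-plane at once, so `x`
  -- is not an interior point of the hull.
  let n : Point := ((b - a).2, -(b - a).1)
  have hcont : Filter.Tendsto (fun t : ℝ => x + t • n) (nhds 0) (nhds x) := by
    have : Continuous fun t : ℝ => x + t • n := by fun_prop
    simpa using this.tendsto 0
  have hev := hcont.eventually (mem_interior_iff_mem_nhds.1 hint)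
  obtain ⟨t, ht, ht0⟩ := ((hev.filter_mono nhdsWithin_le_nhds).and
    (self_mem_nhdsWithin : Set.Ioi (0 : ℝ) ∈ nhdsWithin 0 (Set.Ioi 0))).exists
  have ht0 : 0 < t := ht0
  have hn := hsub _ ht
  have e : orient a b (x + t • n) = orient a b x - t * ((b.1 - a.1) ^ 2 + (b.2 - a.2) ^ 2) := by
    simp only [n, orient, cross, Prod.fst_sub, Prod.snd_sub, Prod.fst_add, Prod.snd_add,
      Prod.smul_fst, Prod.smul_snd, smul_eq_mul]; ring
  have hpos : 0 < (b.1 - a.1) ^ 2 + (b.2 - a.2) ^ 2 := by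
    by_contra! hle
    have h₁ : b.1 - a.1 = 0 := by nlinarith [sq_nonneg (b.1 - a.1), sq_nonneg (b.2 - a.2)]
    have h₂ : b.2 - a.2 = 0 := by nlinarith [sq_nonneg (b.1 - a.1), sq_nonneg (b.2 - a.2)]
    exact hab (Prod.ext (by linarith) (by linarith))
  have := mul_pos ht0 hpos
  rw [e, h0] at hn
  linarith

end Caps

/-! ### The tree of the recursive calls -/

/-- `m` is the point of rank `⌈|S| / 2⌉` of `S` from left to right. -/
def IsMedian (ε : ℝ) (S : Finset Point) (m : Point) : Prop :=
  m ∈ S ∧ (S.filter (fun x => tilt ε x < tilt ε m)).card = (S.card - 1) / 2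

/-- `T` is the tree of the recursive calls on `S` with root edge `pq`, and `F` is the sum of the
sizes of the point sets of these calls. -/
inductive KTree (ε : ℝ) : Finset Point → Point → Point → QTree → ℕ → Prop
  | nil (p : Point) : KTree ε {p} p p .nil 0
  | node {S : Finset Point} {p q m r s : Point} {L R : QTree} {F₁ F₂ : ℕ} :
      Rooted ε S p q → p ≠ q → IsMedian ε S m → IsBridge ε S m r s →
      KTree ε (cap S p r) p r L F₁ → KTree ε (cap S s q) s q R F₂ →
      KTree ε S p q (.node p q s r L R) (S.card + F₁ + F₂)

section

variable {ε : ℝ} {S : Finset Point} {p q : Point} {T : QTree} {F : ℕ}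

theorem IsMedian.unique {m m' : Point} (hS : IsTilt ε S) (h : IsMedian ε S m)
    (h' : IsMedian ε S m') : m = m' := by
  have key : ∀ m m' : Point, IsMedian ε S m → IsMedian ε S m' → ¬ tilt ε m < tilt ε m' := by
    intro m m' h h' hlt
    have : S.filter (fun x => tilt ε x < tilt ε m) ⊂ S.filter (fun x => tilt ε x < tilt ε m') := by
      rw [Finset.ssubset_iff_of_subset]
      · exact ⟨m, by simp [h.1, hlt], by simp⟩
      · intro x hx
        rw [Finset.mem_filter] at hx ⊢
        exact ⟨hx.1, hx.2.trans hlt⟩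
    have := Finset.card_lt_card this
    rw [h.2, h'.2] at this
    exact lt_irrefl _ this
  exact hS.inj h.1 h'.1 (le_antisymm (not_lt.1 (key m' m h' h)) (not_lt.1 (key m m' h h')))

theorem KTree.eq_nil (h : KTree ε S p p T F) : T = .nil := by
  cases h with
  | nil => rfl
  | node _ h => exact absurd rfl h

theorem KTree.unique {T' : QTree} {F' : ℕ} (h : KTree ε S p q T F) (h' : KTree ε S p q T' F') :
    T = T' := by
  induction h generalizing T' F' with
  | nil p => exact h'.eq_nil.symm
  | node hR hpq hm hb _ _ ih₁ ih₂ =>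
    cases h' with
    | nil => exact absurd rfl hpq
    | node hR' hpq' hm' hb' h₁ h₂ =>
      obtain rfl := hm.unique hR.isTilt hm'
      obtain ⟨rfl, rfl⟩ := hb.unique hR.gp hb'
      rw [ih₁ h₁, ih₂ h₂]

theorem KTree.mem_convexHull (h : KTree ε S p q T F) {x : Point} (hx : InTree T x) :
    x ∈ convexHull ℝ (S : Set Point) := by
  induction h with
  | nil => exact hx.elim
  | @node S p q m r s L R F₁ F₂ hR hpq hm hb h₁ h₂ ih₁ ih₂ =>
    rcases hx with hx | hx | hx
    · refine convexHull_mono ?_ hx.1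
      intro y hy
      rcases hy with rfl | rfl | rfl | rfl
      exacts [hR.left_mem, hR.right_mem, hb.2.1, hb.1]
    · exact convexHull_mono (cap_subset _ _ _) (ih₁ hx)
    · exact convexHull_mono (cap_subset _ _ _) (ih₂ hx)

theorem Prec.inTree {T : QTree} {x y : Point} (h : Prec T x y) : InTree T x ∧ InTree T y := by
  induction T with
  | nil => exact h.elim
  | node p q s r L R ih₁ ih₂ =>
    rcases h with ⟨h, h'⟩ | ⟨h, h', -⟩ | h | h
    · exact ⟨Or.inl h, Or.inr h'⟩
    · exact ⟨Or.inl h, Or.inl h'⟩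
    · exact ⟨Or.inr (Or.inl (ih₁ h).1), Or.inr (Or.inl (ih₁ h).2)⟩
    · exact ⟨Or.inr (Or.inr (ih₂ h).1), Or.inr (Or.inr (ih₂ h).2)⟩

/-- Populations are defined by quadrangles alone. This recovers that a point of `S` in a population
of a subtree takes part in the corresponding call: it lies in the convex hull of the cap, hence on
or above `ab`. -/
theorem KTree.mem_cap {a b x : Point} (h : KTree ε (cap S a b) a b T F) (hx : x ∈ S)
    (hT : InTree T x) : x ∈ cap S a b := by
  by_cases hab : a = b
  · subst hab
    rw [h.eq_nil] at hT
    exact hT.elim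
  · rw [mem_cap_of_ne hab]
    exact ⟨hx, convexHull_subset_orient_nonneg
      (fun y hy => ((mem_cap_of_ne hab).1 (Finset.mem_coe.1 hy)).2) x (h.mem_convexHull hT)⟩

/-- The induction step for one side. It treats `a = b` separately, where `piece V a b` is all of `V`
instead of one point, which does no harm because the subtree is empty. -/
theorem isQuadTree_piece {V : Finset Point} {a b : Point}
    (h : KTree ε (cap S a b) a b T F) (hVS : V ⊆ S)
    (hV : ∀ i j, IsUpperEdge ε (cap S a b) i j → i ∈ V ∧ j ∈ V)
    (ih : ∀ V' : Finset Point, V' ⊆ cap S a b →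
      (∀ i j, IsUpperEdge ε (cap S a b) i j → i ∈ V' ∧ j ∈ V') → IsQuadTree V' a b T) :
    IsQuadTree (piece V a b) a b T := by
  by_cases hab : a = b
  · subst hab
    rw [h.eq_nil]
    rfl
  · refine ih _ (fun x hx => ?_) (fun i j hij => ?_)
    · simp only [piece, Finset.mem_filter] at hx
      exact (mem_cap_of_ne hab).2 ⟨hVS hx.1, hx.2⟩
    · simp only [piece, Finset.mem_filter]
      exact ⟨⟨(hV i j hij).1, ((mem_cap_of_ne hab).1 hij.1).2⟩,
        ⟨(hV i j hij).2, ((mem_cap_of_ne hab).1 hij.2.1).2⟩⟩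

/-- Instead of hull vertices of the caps, the induction uses any `V` inside `S` that contains the
ends of all upper edges. This property passes to the pieces, since upper edges of a cap are upper
edges of `S`. -/
theorem KTree.isQuadTree {V : Finset Point} (h : KTree ε S p q T F) (hVS : V ⊆ S)
    (hV : ∀ i j, IsUpperEdge ε S i j → i ∈ V ∧ j ∈ V) : IsQuadTree V p q T := by
  induction h generalizing V with
  | nil => rfl
  | @node S p q m r s L R F₁ F₂ hR hpq hm hb h₁ h₂ ih₁ ih₂ =>
    have he := hb.isUpperEdge
    have hrs := he.2.2.1
    refine ⟨hpq, rfl, rfl, (hV r s he).1, (hV r s he).2, ?_, ?_, ?_,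
      fun v hv => he.2.2.2 v (hVS hv),
      isQuadTree_piece h₁ hVS (fun i j hij => hV i j (hR.isUpperEdge_of_left_cap he hij))
        fun V' => ih₁,
      isQuadTree_piece h₂ hVS (fun i j hij => hV i j (hR.isUpperEdge_of_right_cap he hij))
        fun V' => ih₂⟩
    · rintro rfl; exact lt_irrefl _ hrs
    · rintro rfl; exact absurd (hR.le_right s he.2.1) (not_le.2 hrs)
    · rintro rfl; exact absurd (hR.left_le r he.1) (not_le.2 hrs)

/-- At the call where `x` drops out of both caps, `r` or `s` is farther from the root edge. This
makes ordered downdrafts exist, so the quotient in the theorem has a nonzero denominator. -/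
theorem KTree.exists_prec {V : Finset Point} (h : KTree ε S p q T F) (hp : p ∈ V) (hq : q ∈ V)
    (hV : ∀ i j, IsUpperEdge ε S i j → i ∈ V ∧ j ∈ V) {x : Point} (hx : x ∈ S) (hxV : x ∉ V) :
    ∃ y ∈ S, Prec T x y := by
  induction h with
  | nil => rw [Finset.mem_singleton.1 hx] at hxV; exact absurd hp hxV
  | @node S p q m r s L R F₁ F₂ hR hpq hm hb h₁ h₂ ih₁ ih₂ =>
    have he := hb.isUpperEdge
    by_cases hx₁ : x ∈ cap S p r
    · obtain ⟨y, hy, hxy⟩ := ih₁ hp (hV r s he).1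
        (fun i j hij => hV i j (hR.isUpperEdge_of_left_cap he hij)) hx₁
      exact ⟨y, cap_subset _ _ _ hy, Or.inr (Or.inr (Or.inl hxy))⟩
    by_cases hx₂ : x ∈ cap S s q
    · obtain ⟨y, hy, hxy⟩ := ih₂ (hV r s he).2 hq
        (fun i j hij => hV i j (hR.isUpperEdge_of_right_cap he hij)) hx₂
      exact ⟨y, cap_subset _ _ _ hy, Or.inr (Or.inr (Or.inr hxy))⟩
    obtain ⟨hq, hpos, hlt⟩ := hR.quadrangle hpq he hx hx₁ hx₂
    rcases hlt with hlt | hlt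
    · exact ⟨r, he.1, Or.inr (Or.inl ⟨⟨hq, hpos.ne'⟩,
        ⟨subset_convexHull ℝ _ (by simp), (hpos.trans hlt).ne'⟩, hlt⟩)⟩
    · exact ⟨s, he.2.1, Or.inr (Or.inl ⟨⟨hq, hpos.ne'⟩,
        ⟨subset_convexHull ℝ _ (by simp), (hpos.trans hlt).ne'⟩, hlt⟩)⟩

/-! ### Regions of the points -/

theorem card_filter_le_of_isMedian {m : Point} (hS : IsTilt ε S) (hm : IsMedian ε S m) :
    (S.filter (fun x => tilt ε x ≤ tilt ε m)).card = (S.card - 1) / 2 + 1 := by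
  have : S.filter (fun x => tilt ε x ≤ tilt ε m) =
      insert m (S.filter (fun x => tilt ε x < tilt ε m)) := by
    ext x
    simp only [Finset.mem_filter, Finset.mem_insert]
    constructor
    · rintro ⟨hx, h⟩
      rcases h.lt_or_eq with h | h
      · exact Or.inr ⟨hx, h⟩
      · exact Or.inl (hS.inj hx hm.1 h)
    · rintro (rfl | ⟨hx, h⟩)
      · exact ⟨hm.1, le_rfl⟩
      · exact ⟨hx, h.le⟩
  rw [this, Finset.card_insert_of_notMem (by simp), hm.2]

theorem Rooted.two_le_card (h : Rooted ε S p q) (hpq : p ≠ q) : 2 ≤ S.card :=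
  Finset.one_lt_card.2 ⟨p, h.left_mem, q, h.right_mem, hpq⟩

/-- The left cap contains no point to the right of `r`, hence none to the right of the median. -/
theorem Rooted.card_left_cap_le {m r s : Point} (h : Rooted ε S p q) (hm : IsMedian ε S m)
    (hb : IsBridge ε S m r s) : (cap S p r).card ≤ (S.card + 1) / 2 := by
  have hpos := Finset.card_pos.2 ⟨m, hm.1⟩
  have : cap S p r ⊆ S.filter (fun x => tilt ε x ≤ tilt ε m) := fun x hx =>
    Finset.mem_filter.2 ⟨cap_subset _ _ _ hx,
      (h.le_of_mem_left_cap hb.isUpperEdge hx).trans hb.2.2.1⟩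
  have := Finset.card_le_card this
  rw [card_filter_le_of_isMedian h.isTilt hm] at this
  omega

theorem Rooted.card_right_cap_le {m r s : Point} (h : Rooted ε S p q) (hm : IsMedian ε S m)
    (hb : IsBridge ε S m r s) : (cap S s q).card ≤ (S.card + 1) / 2 := by
  have hpos := Finset.card_pos.2 ⟨m, hm.1⟩
  have : cap S s q ⊆ S.filter (fun x => ¬ tilt ε x ≤ tilt ε m) := fun x hx =>
    Finset.mem_filter.2 ⟨cap_subset _ _ _ hx,
      not_le.2 (hb.2.2.2.1.trans_le (h.le_of_mem_right_cap hb.isUpperEdge hx))⟩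
  have := Finset.card_le_card this
  have hsum := S.card_filter_add_card_filter_not (fun x => tilt ε x ≤ tilt ε m)
  rw [card_filter_le_of_isMedian h.isTilt hm] at hsum
  omega

/-- The gain of one level of recursion: `k ≤ 3n / 4` even after rounding, as `n ≥ 2`, and `log t ≤ t
- 1` turns this into `log (k / n) ≤ -1 / 4`. -/
theorem mul_log_half_le {k n : ℕ} (hn : 2 ≤ n) (hk : k ≤ (n + 1) / 2) :
    (k : ℝ) * Real.log k + k / 4 ≤ k * Real.log n := by
  rcases Nat.eq_zero_or_pos k with rfl | hpos
  · simp
  have hk' : 0 < (k : ℝ) := by exact_mod_cast hpos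
  have hn' : 0 < (n : ℝ) := by exact_mod_cast (by omega : 0 < n)
  have h4 : (4 : ℝ) * k ≤ 3 * n := by exact_mod_cast (by omega : 4 * k ≤ 3 * n)
  have h₁ : Real.log (k / n) ≤ k / n - 1 := Real.log_le_sub_one_of_pos (by positivity)
  have h₂ : (k : ℝ) / n ≤ 3 / 4 := by rw [div_le_iff₀ hn']; linarith
  rw [Real.log_div hk'.ne' hn'.ne'] at h₁
  have h₃ : Real.log k + 1 / 4 ≤ Real.log n := by linarith
  have := mul_le_mul_of_nonneg_left h₃ hk'.le
  linarith

/-- Every point gets the point set of the last call that it takes part in. -/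
theorem KTree.exists_regions {V : Finset Point} (h : KTree ε S p q T F)
    (hV : ∀ i j, IsUpperEdge ε S i j → i ∈ V ∧ j ∈ V) :
    ∃ A : Point → Finset Point,
      (∀ x ∈ S, x ∈ A x ∧ A x ⊆ S) ∧
      (∀ x ∈ S, ∀ y ∈ S, A x ⊆ A y ∨ A y ⊆ A x ∨ Disjoint (A x) (A y)) ∧
      (∀ x ∈ S, x ∉ V → ∀ y ∈ S, Prec T x y → y ∈ A x) ∧
      ∑ x ∈ S, Real.log (A x).card + F / 4 ≤ S.card * Real.log S.card + S.card / 4 := by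
  classical
  induction h with
  | nil p =>
    refine ⟨fun _ => {p}, by simp, fun _ _ _ _ => Or.inl subset_rfl,
      fun _ _ _ _ _ h => h.elim, by simp⟩
  | @node S p q m r s L R F₁ F₂ hR hpq hm hb h₁ h₂ ih₁ ih₂ =>
    have he := hb.isUpperEdge
    obtain ⟨A₁, a₁, b₁, c₁, d₁⟩ := ih₁ fun i j hij => hV i j (hR.isUpperEdge_of_left_cap he hij)
    obtain ⟨A₂, a₂, b₂, c₂, d₂⟩ := ih₂ fun i j hij => hV i j (hR.isUpperEdge_of_right_cap he hij)
    have hdisj := hR.disjoint_caps he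
    have hcard₁ := mul_log_half_le (hR.two_le_card hpq) (hR.card_left_cap_le hm hb)
    have hcard₂ := mul_log_half_le (hR.two_le_card hpq) (hR.card_right_cap_le hm hb)
    have hs₁ := cap_subset S p r
    have hs₂ := cap_subset S s q
    obtain ⟨A, hA⟩ : ∃ A : Point → Finset Point, A = fun x =>
      if x ∈ cap S p r then A₁ x else if x ∈ cap S s q then A₂ x else S := ⟨_, rfl⟩
    have e₁ : ∀ x ∈ cap S p r, A x = A₁ x := fun x hx => by simp [hA, hx]
    have e₂ : ∀ x ∈ cap S s q, A x = A₂ x := fun x hx => by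
      simp [hA, hx, Finset.disjoint_right.1 hdisj hx]
    have e₀ : ∀ x, x ∉ cap S p r → x ∉ cap S s q → A x = S := fun x h h' => by simp [hA, h, h']
    have hsub : ∀ x ∈ S, x ∈ A x ∧ A x ⊆ S := by
      intro x hx
      by_cases hx₁ : x ∈ cap S p r
      · rw [e₁ x hx₁]; exact ⟨(a₁ x hx₁).1, (a₁ x hx₁).2.trans hs₁⟩
      by_cases hx₂ : x ∈ cap S s q
      · rw [e₂ x hx₂]; exact ⟨(a₂ x hx₂).1, (a₂ x hx₂).2.trans hs₂⟩
      rw [e₀ x hx₁ hx₂]; exact ⟨hx, subset_rfl⟩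
    refine ⟨A, hsub, ?_, ?_, ?_⟩
    · intro x hx y hy
      by_cases hx₁ : x ∈ cap S p r
      · by_cases hy₁ : y ∈ cap S p r
        · rw [e₁ x hx₁, e₁ y hy₁]; exact b₁ x hx₁ y hy₁
        by_cases hy₂ : y ∈ cap S s q
        · rw [e₁ x hx₁, e₂ y hy₂]
          exact Or.inr (Or.inr (hdisj.mono (a₁ x hx₁).2 (a₂ y hy₂).2))
        rw [e₀ y hy₁ hy₂]; exact Or.inl (hsub x hx).2
      by_cases hx₂ : x ∈ cap S s q
      · by_cases hy₁ : y ∈ cap S p r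
        · rw [e₂ x hx₂, e₁ y hy₁]
          exact Or.inr (Or.inr (hdisj.symm.mono (a₂ x hx₂).2 (a₁ y hy₁).2))
        by_cases hy₂ : y ∈ cap S s q
        · rw [e₂ x hx₂, e₂ y hy₂]; exact b₂ x hx₂ y hy₂
        rw [e₀ y hy₁ hy₂]; exact Or.inl (hsub x hx).2
      rw [e₀ x hx₁ hx₂]; exact Or.inr (Or.inl (hsub y hy).2)
    · intro x hx hxV y hy hxy
      by_cases hx₁ : x ∈ cap S p r
      · by_cases hxy' : Prec L x y
        · rw [e₁ x hx₁]
          exact c₁ x hx₁ hxV y (h₁.mem_cap hy hxy'.inTree.2) hxy'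
        · exfalso
          -- All corners lie on or below the line `pr`, and `x` is on or above it, so a common point
          -- would be on the line: it is `p`, which is on the root edge and so in no population of
          -- this node, or `r`, which belongs to `V`.
          have hpop : ¬ InPopulation p q s r x := by
            rintro ⟨hconv, hne⟩
            have hxp : x ≠ p := by rintro rfl; simp at hne
            have hxr : x ≠ r := by rintro rfl; exact hxV (hV _ s he).1
            have hpr : p ≠ r := by
              rintro rfl
              rw [cap_self he.1, Finset.mem_singleton] at hx₁
              exact hxp hx₁
            have h0 := ((mem_cap_of_ne hpr).1 hx₁).2
            have hrp : ∀ z ∈ ({p, q, s, r} : Set Point), 0 ≤ orient r p z := by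
              have hout : ∀ z ∈ S, tilt ε r < tilt ε z → 0 ≤ orient r p z := by
                intro z hz hlt
                by_contra! hneg
                rw [orient_swap] at hneg
                have := hR.le_of_mem_left_cap he ((mem_cap_of_ne hpr).2 ⟨hz, by linarith⟩)
                linarith
              rintro z (rfl | rfl | rfl | rfl)
              · simp
              · exact hout _ hR.right_mem (he.2.2.1.trans_le (hR.le_right _ he.2.1))
              · exact hout _ he.2.1 he.2.2.1
              · simp
            have h0' := convexHull_subset_orient_nonneg hrp x hconv
            rw [orient_swap] at h0'
            rcases hR.gp.orient_eq_zero hR.left_mem he.1 hx hpr (by linarith) with h | h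
            exacts [hxp h, hxr h]
          rcases hxy with ⟨h, -⟩ | ⟨h, -⟩ | h | h
          · exact hpop h
          · exact hpop h
          · exact hxy' h
          · exact Finset.disjoint_left.1 hdisj hx₁ (h₂.mem_cap hx h.inTree.1)
      by_cases hx₂ : x ∈ cap S s q
      · by_cases hxy' : Prec R x y
        · rw [e₂ x hx₂]
          exact c₂ x hx₂ hxV y (h₂.mem_cap hy hxy'.inTree.2) hxy'
        · exfalso
          have hpop : ¬ InPopulation p q s r x := by
            rintro ⟨hconv, hne⟩
            have hxq : x ≠ q := by rintro rfl; simp at hne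
            have hxs : x ≠ s := by rintro rfl; exact hxV (hV r _ he).2
            have hsq : s ≠ q := by
              rintro rfl
              rw [cap_self he.2.1, Finset.mem_singleton] at hx₂
              exact hxq hx₂
            have h0 := ((mem_cap_of_ne hsq).1 hx₂).2
            have hqs : ∀ z ∈ ({p, q, s, r} : Set Point), 0 ≤ orient q s z := by
              have hout : ∀ z ∈ S, tilt ε z < tilt ε s → 0 ≤ orient q s z := by
                intro z hz hlt
                by_contra! hneg
                rw [orient_swap] at hneg
                have := hR.le_of_mem_right_cap he ((mem_cap_of_ne hsq).2 ⟨hz, by linarith⟩)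
                linarith
              rintro z (rfl | rfl | rfl | rfl)
              · exact hout _ hR.left_mem ((hR.left_le _ he.1).trans_lt he.2.2.1)
              · simp
              · simp
              · exact hout _ he.1 he.2.2.1
            have h0' := convexHull_subset_orient_nonneg hqs x hconv
            rw [orient_swap] at h0'
            rcases hR.gp.orient_eq_zero he.2.1 hR.right_mem hx hsq (by linarith) with h | h
            exacts [hxs h, hxq h]
          rcases hxy with ⟨h, -⟩ | ⟨h, -⟩ | h | h
          · exact hpop h
          · exact hpop h
          · exact hx₁ (h₁.mem_cap hx h.inTree.1)
          · exact hxy' h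
      rw [e₀ x hx₁ hx₂]; exact hy
    · have hun : cap S p r ∪ cap S s q ⊆ S := Finset.union_subset hs₁ hs₂
      have hsum := Finset.sum_sdiff (f := fun x => Real.log (A x).card) hun
      have g₁ : ∑ x ∈ cap S p r, Real.log (A x).card = ∑ x ∈ cap S p r, Real.log (A₁ x).card :=
        Finset.sum_congr rfl fun x hx => by rw [e₁ x hx]
      have g₂ : ∑ x ∈ cap S s q, Real.log (A x).card = ∑ x ∈ cap S s q, Real.log (A₂ x).card :=
        Finset.sum_congr rfl fun x hx => by rw [e₂ x hx]
      have g₀ : ∑ x ∈ S \ (cap S p r ∪ cap S s q), Real.log (A x).card =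
          (S \ (cap S p r ∪ cap S s q)).card * Real.log S.card := by
        rw [← nsmul_eq_mul, ← Finset.sum_const]
        refine Finset.sum_congr rfl fun x hx => ?_
        simp only [Finset.mem_sdiff, Finset.mem_union, not_or] at hx
        rw [e₀ x hx.2.1 hx.2.2]
      rw [Finset.sum_union hdisj, g₀, g₁, g₂] at hsum
      have hc := Finset.card_sdiff_add_card_eq_card hun
      rw [Finset.card_union_of_disjoint hdisj] at hc
      have hc' : (S.card : ℝ) = (S \ (cap S p r ∪ cap S s q)).card + (cap S p r).card +
          (cap S s q).card := by exact_mod_cast (by omega)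
      push_cast
      rw [← hsum]
      have e : (S.card : ℝ) * Real.log S.card = (S \ (cap S p r ∪ cap S s q)).card *
          Real.log S.card + (cap S p r).card * Real.log S.card +
          (cap S s q).card * Real.log S.card := by
        nth_rewrite 1 [hc']; ring
      -- By `hcard₁` and `hcard₂` the bounds of the two caps, with their terms of a quarter of the
      -- size, are at most cap size times `log S.card`. The term `S.card / 4` of the claim pays for
      -- the current call.
      linarith

end

/-! ### The algorithm -/

theorem giveWitness_time (pl pr pj pi : Point) (l : List Point) (out : Output) :
    (giveWitness pl pr pj pi l out).time = 2 * l.length + 1 := by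
  induction l generalizing out with
  | nil => simp [giveWitness]
  | cons x l ih => simp [giveWitness, ih, onOrAboveTest]; omega

theorem card_toFinset_filter {l : List Point} (hd : l.Nodup) (f : Point → Prop)
    [DecidablePred f] : (l.toFinset.filter f).card = l.countP (fun x => f x) := by
  rw [List.countP_eq_length_filter, ← List.toFinset_card_of_nodup (hd.filter _)]
  congr 1
  ext x
  simp

/-- Ranks count from `0`, so `(n - 1) / 2` is the rank `⌈n / 2⌉` counted from `1`. The tilted
coordinate has no ties, which turns the two inequalities of `HasRank` into an equality. -/
theorem HasRank.isMedian {ε : ℝ} {l : List Point} {m : Point} (hS : IsTilt ε l.toFinset)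
    (hd : l.Nodup) (h : HasRank (tilt ε) l ((l.length - 1) / 2) m) :
    IsMedian ε l.toFinset m := by
  obtain ⟨hm, h₁, h₂⟩ := h
  refine ⟨by simpa using hm, ?_⟩
  rw [← card_toFinset_filter hd] at h₁ h₂
  have : l.toFinset.filter (fun x => tilt ε x ≤ tilt ε m) ⊆
      insert m (l.toFinset.filter (fun x => tilt ε x < tilt ε m)) := by
    intro x hx
    obtain ⟨hx, hle⟩ := Finset.mem_filter.1 hx
    rcases hle.lt_or_eq with h | h
    · exact Finset.mem_insert_of_mem (Finset.mem_filter.2 ⟨hx, h⟩)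
    · exact Finset.mem_insert.2 (Or.inl (hS.inj hx (by simpa using hm) h))
  have := (Finset.card_le_card this).trans (Finset.card_insert_le _ _)
  rw [List.toFinset_card_of_nodup hd]
  omega

theorem Rooted.exists_isBridge {ε : ℝ} {S : Finset Point} {p q m : Point} (h : Rooted ε S p q)
    (hpq : p ≠ q) (hm : IsMedian ε S m) : ∃ r s, IsBridge ε S m r s := by
  refine KMS.exists_isBridge hm.1 h.right_mem ?_
  by_contra! hle
  have h₁ := card_filter_le_of_isMedian h.isTilt hm
  rw [Finset.filter_true_of_mem fun x hx => (h.le_right x hx).trans hle] at h₁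
  have := h.two_le_card hpq
  omega

theorem onOrAboveTest_ret (a b x : Point) :
    (onOrAboveTest a b x).ret = true ↔ if a = b then x = a else 0 ≤ orient a b x := by
  simp [onOrAboveTest]

theorem filterList_toFinset (l : List Point) (a b : Point) :
    (filterList (onOrAboveTest a b) l).ret.toFinset = cap l.toFinset a b := by
  rw [filterList_ret]
  ext x
  simp only [List.mem_toFinset, List.mem_filter, mem_cap, onOrAboveTest_ret]

theorem Rooted.eq_singleton {ε : ℝ} {S : Finset Point} {p : Point} (h : Rooted ε S p p) :
    S = {p} := by
  ext x
  rw [Finset.mem_singleton]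
  constructor
  · intro hx
    exact h.isTilt.inj hx h.left_mem (le_antisymm (h.le_right x hx) (h.left_le x hx))
  · rintro rfl
    exact h.left_mem

theorem kms_spec {ε : ℝ} {fuel : ℕ} {l : List Point} {p q : Point} (out : Output)
    (h : Rooted ε l.toFinset p q) (hd : l.Nodup) (hf : l.length ≤ fuel) :
    ∃ F, KTree ε l.toFinset p q (kms fuel l p q out).ret.1 F ∧
      (kms fuel l p q out).time ≤ 40000 * F + 2 := by
  induction fuel generalizing l p q out with
  | zero =>
    have : l = [] := List.length_eq_zero_iff.1 (by omega)
    subst this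
    simpa using h.left_mem
  | succ fuel ih =>
    simp only [kms, ret_bind, time_bind, time_tick, eqTest, ret_pure, time_pure]
    by_cases hpq : p = q
    · subst hpq
      refine ⟨0, ?_, by simp⟩
      rw [h.eq_singleton]
      simpa using KTree.nil p
    · have hcard := List.toFinset_card_of_nodup hd
      have htwo := h.two_le_card hpq
      rw [hcard] at htwo
      simp only [hpq, decide_false, Bool.false_eq_true, if_false, ret_bind, time_bind, len_ret,
        len_time]
      have hmem : ∀ x ∈ l, x ∈ l.toFinset := fun x hx => by simpa using hx
      have hcmp := comparesBy_tilt h.isTilt hmem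
      have hm := (select_spec hcmp (k := (l.length - 1) / 2) le_rfl (by omega)).isMedian
        h.isTilt hd
      have hmt := select_time_le (le := lexLeTest) (fun x y => by simp [lexLeTest]) hcmp
        (k := (l.length - 1) / 2) le_rfl (by omega)
      obtain ⟨m, hmdef⟩ : ∃ m, (select lexLeTest l.length ((l.length - 1) / 2) l).ret = m :=
        ⟨_, rfl⟩
      rw [hmdef] at hm ⊢
      obtain ⟨r, s, hb⟩ := h.exists_isBridge hpq hm
      obtain ⟨hbr, hbt⟩ := bridge_spec h.gp h.isTilt hm.1 hmem hd hb le_rfl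
      rw [hbr]
      have he := hb.isUpperEdge
      have hd₁ : (filterList (onOrAboveTest p r) l).ret.Nodup := by
        rw [filterList_ret]; exact hd.filter _
      have hd₂ : (filterList (onOrAboveTest s q) l).ret.Nodup := by
        rw [filterList_ret]; exact hd.filter _
      have hR₁ := h.left_cap he
      have hR₂ := h.right_cap he
      have hc₁ := h.card_left_cap_le hm hb
      have hc₂ := h.card_right_cap_le hm hb
      rw [← filterList_toFinset] at hR₁ hR₂ hc₁ hc₂
      rw [hcard, List.toFinset_card_of_nodup hd₁] at hc₁
      rw [hcard, List.toFinset_card_of_nodup hd₂] at hc₂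
      have ht : ∀ a b x, (onOrAboveTest a b x).time = 1 := fun a b x => by simp [onOrAboveTest]
      have t₁ := filterList_time_le (onOrAboveTest p r) 1 (fun x => (ht _ _ x).le) l
      have t₂ := filterList_time_le (onOrAboveTest s q) 1 (fun x => (ht _ _ x).le) l
      have t₀ := filterList_time_le (fun x => do
          let b₁ ← onOrAboveTest p r x
          let b₂ ← onOrAboveTest s q x
          return (!b₁ && !b₂)) 2 (fun x => by simp [ht]) l
      have l₀ : (filterList (fun x => do
          let b₁ ← onOrAboveTest p r x
          let b₂ ← onOrAboveTest s q x
          return (!b₁ && !b₂)) l).ret.length ≤ l.length := by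
        rw [filterList_ret]; exact List.length_filter_le _ _
      obtain ⟨F₁, k₁, u₁⟩ := ih out hR₁ hd₁ (by omega)
      obtain ⟨F₂, k₂, u₂⟩ := ih
        (kms fuel (filterList (onOrAboveTest p r) l).ret p r out).ret.2 hR₂ hd₂ (by omega)
      rw [filterList_toFinset] at k₁ k₂
      refine ⟨_, KTree.node h hpq hm hb k₁ k₂, ?_⟩
      -- Bridge-finding costs `30000`, selection `2000` and the remaining scans about ten steps per
      -- point. With `n ≥ 2`, the factor `40000` also absorbs the constants, including the `2` of
      -- each recursive call.
      simp only [giveWitness_time, hcard, time_pure]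
      omega

theorem extremes_time (l : List Point) (best : Point × Point) :
    (extremes l best).time = 3 * l.length + 1 := by
  induction l generalizing best with
  | nil => simp [extremes]
  | cons x l ih => simp [extremes, ih, lexLtTest]; omega

theorem extremes_spec {ε : ℝ} {S : Finset Point} (hS : IsTilt ε S) {l : List Point}
    {B : Finset Point} {best : Point × Point} (hB : B ⊆ S) (hl : ∀ x ∈ l, x ∈ S)
    (h : best.1 ∈ B ∧ best.2 ∈ B ∧ ∀ x ∈ B, tilt ε best.1 ≤ tilt ε x ∧ tilt ε x ≤ tilt ε best.2) :
    let t := (extremes l best).ret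
    t.1 ∈ B ∪ l.toFinset ∧ t.2 ∈ B ∪ l.toFinset ∧
      ∀ x ∈ B ∪ l.toFinset, tilt ε t.1 ≤ tilt ε x ∧ tilt ε x ≤ tilt ε t.2 := by
  induction l generalizing B best with
  | nil => simpa [extremes] using h
  | cons x l ih =>
    have hx := hl x (by simp)
    have hun : B ∪ (x :: l).toFinset = insert x B ∪ l.toFinset := by
      ext; simp
    rw [hun]
    obtain ⟨h₁, h₂, h₃⟩ := h
    simp only [extremes, ret_bind]
    rw [lexLtTest_ret hS hx (hB h₁), lexLtTest_ret hS (hB h₂) hx]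
    refine ih (Finset.insert_subset hx hB) (fun y hy => hl y (by simp [hy])) ⟨?_, ?_, ?_⟩
    · simp only; split <;> simp [h₁]
    · simp only; split <;> simp [h₂]
    · have k := h₃ _ h₁
      intro y hy
      simp only [decide_eq_true_eq]
      rcases Finset.mem_insert.1 hy with rfl | hy
      · constructor <;> split <;> linarith
      · have := h₃ y hy
        constructor <;> split <;> linarith

theorem run_spec {ε : ℝ} {l : List Point} {p q : Point} (h : Rooted ε l.toFinset p q)
    (hd : l.Nodup) :
    ∃ F, KTree ε l.toFinset p q (run l).ret.1 F ∧
      (run l).time ≤ 40000 * F + 3 * l.length + 4 := by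
  match l, h, hd with
  | [], h, _ => simpa using h.left_mem
  | x :: xs, h, hd =>
    have hx : x ∈ (x :: xs).toFinset := by simp
    obtain ⟨h₁, h₂, h₃⟩ := extremes_spec h.isTilt (l := xs) (B := {x}) (best := (x, x))
      (by simp) (fun y hy => by simp [hy]) (by simp)
    have hun : {x} ∪ xs.toFinset = (x :: xs).toFinset := by ext; simp
    rw [hun] at h₁ h₂ h₃
    have e₁ : (extremes xs (x, x)).ret.1 = p :=
      h.isTilt.inj h₁ h.left_mem (le_antisymm (h₃ p h.left_mem).1 (h.left_le _ h₁))
    have e₂ : (extremes xs (x, x)).ret.2 = q :=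
      h.isTilt.inj h₂ h.right_mem (le_antisymm (h.le_right _ h₂) (h₃ q h.right_mem).2)
    obtain ⟨F, k, t⟩ := kms_spec ⟨[], []⟩ h hd le_rfl
    have ht := extremes_time xs (x, x)
    simp only [run, ret_bind, time_bind, time_tick, e₁, e₂]
    refine ⟨F, k, ?_⟩
    simp only [List.length_cons] at *
    omega

/-! ### Counting ordered downdrafts -/

section Counting

variable {P : Finset Point} {Q : QTree}

noncomputable instance (P : Finset Point) : Fintype {x : Point // x ∈ P ∧ x ∉ hullVertices P} := by
  classical
  exact Fintype.subtype (P.filter fun x => x ∉ hullVertices P) (by simp)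

/-- `x` and `y` are mapped to the same point, and `x` comes before `y` in the fiber. -/
def OrderedDowndraft.Before (D : OrderedDowndraft P Q)
    (x y : {x : Point // x ∈ P ∧ x ∉ hullVertices P}) : Prop :=
  ∃ h : D.map x = D.map y, D.lt (D.map y) ⟨x, h⟩ ⟨y, rfl⟩

/-- Replaces the family of orders, whose types depend on the map, by one relation on all internal
points; relations of different downdrafts can then be compared directly. -/
theorem OrderedDowndraft.lt_iff_before (D : OrderedDowndraft P Q) {z : {x : Point // x ∈ P}}
    (x y : {x // D.map x = z}) : D.lt z x y ↔ D.Before x.1 y.1 := by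
  obtain ⟨x, hx⟩ := x
  obtain ⟨y, rfl⟩ := y
  exact ⟨fun h => ⟨hx, h⟩, fun ⟨_, h⟩ => h⟩

theorem OrderedDowndraft.before_irrefl (D : OrderedDowndraft P Q) (x) : ¬ D.Before x x := by
  have := D.lt_total (D.map x)
  rintro ⟨_, h⟩
  exact irrefl_of (D.lt (D.map x)) _ h

theorem OrderedDowndraft.before_trans (D : OrderedDowndraft P Q) {x y z}
    (hxy : D.Before x y) (hyz : D.Before y z) : D.Before x z := by
  have := D.lt_total (D.map z)
  have h₁ := hxy.1
  have h₂ := hyz.1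
  have k₁ := (D.lt_iff_before ⟨x, h₁.trans h₂⟩ ⟨y, h₂⟩).2 hxy
  have k₂ := (D.lt_iff_before ⟨y, h₂⟩ ⟨z, rfl⟩).2 hyz
  exact (D.lt_iff_before _ _).1 (trans_of (D.lt (D.map z)) k₁ k₂)

theorem OrderedDowndraft.before_trichotomy (D : OrderedDowndraft P Q) {x y}
    (h : D.map x = D.map y) : D.Before x y ∨ x = y ∨ D.Before y x := by
  have := D.lt_total (D.map y)
  rcases trichotomous_of (D.lt (D.map y)) ⟨x, h⟩ ⟨y, rfl⟩ with k | k | k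
  · exact Or.inl ((D.lt_iff_before _ _).1 k)
  · exact Or.inr (Or.inl (congrArg Subtype.val k))
  · exact Or.inr (Or.inr ((D.lt_iff_before _ _).1 k))

theorem OrderedDowndraft.ext_before {D D' : OrderedDowndraft P Q} (hmap : D.map = D'.map)
    (h : ∀ x y, D.Before x y ↔ D'.Before x y) : D = D' := by
  have hlt := fun z x y => D.lt_iff_before (z := z) x y
  have hlt' := fun z x y => D'.lt_iff_before (z := z) x y
  obtain ⟨f, hf, lt, ht⟩ := D
  obtain ⟨f', hf', lt', ht'⟩ := D'
  obtain rfl : f = f' := hmap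
  obtain rfl : lt = lt' := by
    funext z x y
    exact propext ((hlt z x y).trans ((h _ _).trans (hlt' z x y).symm))
  rfl

/-- Without finiteness `Nat.card` would have the default value `0`. -/
instance (P : Finset Point) (Q : QTree) : Finite (OrderedDowndraft P Q) := by
  refine Finite.of_injective (β := ({x : Point // x ∈ P ∧ x ∉ hullVertices P} →
      {x : Point // x ∈ P}) × ({x : Point // x ∈ P ∧ x ∉ hullVertices P} →
      {x : Point // x ∈ P ∧ x ∉ hullVertices P} → Prop)) (fun D => (D.map, D.Before)) ?_
  intro D D' h
  obtain ⟨h₁, h₂⟩ := Prod.mk.inj h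
  exact OrderedDowndraft.ext_before h₁ fun x y => by rw [h₂]

theorem nonempty_orderedDowndraft
    (h : ∀ x ∈ P, x ∉ hullVertices P → ∃ y ∈ P, Prec Q x y) : Nonempty (OrderedDowndraft P Q) := by
  choose! f hf hf' using h
  exact ⟨{ map := fun x => ⟨f x.1, hf x.1 x.2.1 x.2.2⟩
           prec_map := fun x => hf' x.1 x.2.1 x.2.2
           lt := fun _ => WellOrderingRel
           lt_total := fun _ => inferInstance }⟩

/-- A predecessor of `x` in its fiber among the points of smaller rank, as near to `x` as
possible. -/
def OrderedDowndraft.IsPred (D : OrderedDowndraft P Q) (rank : Point → ℕ)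
    (x x' : {x : Point // x ∈ P ∧ x ∉ hullVertices P}) : Prop :=
  rank x' < rank x ∧ D.Before x' x ∧
    ∀ z, rank z.1 < rank x → D.Before z x → z = x' ∨ D.Before z x'

theorem OrderedDowndraft.exists_isPred (D : OrderedDowndraft P Q) (rank : Point → ℕ) {x}
    (h : ∃ z : {x : Point // x ∈ P ∧ x ∉ hullVertices P}, rank z.1 < rank x.1 ∧ D.Before z x) :
    ∃ x', D.IsPred rank x x' := by
  classical
  let B : Set {x : Point // x ∈ P ∧ x ∉ hullVertices P} :=
    {z | rank z.1 < rank x.1 ∧ D.Before z x}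
  -- `Before` is a strict order on a finite type, so its converse is well-founded; a minimal element
  -- for the converse is the candidate nearest to `x`.
  have htr : IsTrans _ (fun a b => D.Before b a) := ⟨fun a b c h₁ h₂ => D.before_trans h₂ h₁⟩
  have hir : Std.Irrefl (fun a b => D.Before b a) := ⟨fun a => D.before_irrefl a⟩
  have hwf : WellFounded (fun a b => D.Before b a) := Finite.wellFounded_of_trans_of_irrefl _
  obtain ⟨x', hx', hmin⟩ := hwf.has_min B h
  refine ⟨x', hx'.1, hx'.2, fun z hz hzx => ?_⟩
  rcases D.before_trichotomy (hzx.1.trans hx'.2.1.symm) with k | k | k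
  · exact Or.inr k
  · exact Or.inl k
  · exact absurd k (hmin z ⟨hz, hzx⟩)

open Classical in
/-- The position of `x` in the insertion order that is given by `rank`: behind a point of smaller
rank, or at the front of a fiber. -/
noncomputable def OrderedDowndraft.code (D : OrderedDowndraft P Q) (rank : Point → ℕ)
    (x : {x : Point // x ∈ P ∧ x ∉ hullVertices P}) : Point ⊕ Point :=
  if h : ∃ z : {x : Point // x ∈ P ∧ x ∉ hullVertices P}, rank z.1 < rank x.1 ∧ D.Before z x
  then Sum.inr (D.exists_isPred rank h).choose.1
  else Sum.inl (D.map x).1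

theorem OrderedDowndraft.code_spec (D : OrderedDowndraft P Q) (rank : Point → ℕ)
    (x : {x : Point // x ∈ P ∧ x ∉ hullVertices P}) :
    (∃ x', D.IsPred rank x x' ∧ D.code rank x = Sum.inr x'.1) ∨
    ((∀ z : {x : Point // x ∈ P ∧ x ∉ hullVertices P}, rank z.1 < rank x.1 → ¬ D.Before z x) ∧
      D.code rank x = Sum.inl (D.map x).1) := by
  by_cases h : ∃ z : {x : Point // x ∈ P ∧ x ∉ hullVertices P}, rank z.1 < rank x.1 ∧ D.Before z x
  · refine Or.inl ⟨_, (D.exists_isPred rank h).choose_spec, ?_⟩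
    rw [OrderedDowndraft.code, dif_pos h]
  · refine Or.inr ⟨fun z hz hzx => h ⟨z, hz, hzx⟩, ?_⟩
    rw [OrderedDowndraft.code, dif_neg h]

/-- The code is a record of an insertion process and can be replayed: inserting the points by
increasing rank, the code of each point determines its fiber and its place among the points that are
already there. -/
theorem OrderedDowndraft.code_injective {rank : Point → ℕ} (hrank : Set.InjOn rank P) :
    Function.Injective (fun D : OrderedDowndraft P Q => D.code rank) := by
  intro D D' hcode
  have hcode : ∀ x, D.code rank x = D'.code rank x := congrFun hcode
  have hinj : ∀ x y : {x : Point // x ∈ P ∧ x ∉ hullVertices P}, rank x.1 = rank y.1 → x = y :=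
    fun x y h => Subtype.ext (hrank x.2.1 y.2.1 h)
  -- maps and orders agree on the points of rank less than `k`
  have key : ∀ k : ℕ, (∀ x : {x : Point // x ∈ P ∧ x ∉ hullVertices P}, rank x.1 < k →
      D.map x = D'.map x) ∧
      (∀ x y : {x : Point // x ∈ P ∧ x ∉ hullVertices P}, rank x.1 < k → rank y.1 < k →
      (D.Before x y ↔ D'.Before x y)) := by
    intro k
    induction k with
    | zero => simp
    | succ k ih =>
      obtain ⟨ih₁, ih₂⟩ := ih
      have new : ∀ x : {x : Point // x ∈ P ∧ x ∉ hullVertices P}, rank x.1 = k →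
          D.map x = D'.map x ∧ ∀ z : {x : Point // x ∈ P ∧ x ∉ hullVertices P}, rank z.1 < k →
            (D.Before z x ↔ D'.Before z x) := by
        rintro x rfl
        rcases D.code_spec rank x with ⟨x', hx', hc⟩ | ⟨hx', hc⟩ <;>
        rcases D'.code_spec rank x with ⟨y', hy', hc'⟩ | ⟨hy', hc'⟩
        · rw [hcode, hc'] at hc
          obtain rfl : x' = y' := Subtype.ext (Sum.inr.inj hc).symm
          refine ⟨hx'.2.1.1.symm.trans ((ih₁ x' hx'.1).trans hy'.2.1.1), fun z hz => ⟨?_, ?_⟩⟩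
          · intro h
            rcases hx'.2.2 z hz h with rfl | h
            · exact hy'.2.1
            · exact D'.before_trans ((ih₂ z x' hz hx'.1).1 h) hy'.2.1
          · intro h
            rcases hy'.2.2 z hz h with rfl | h
            · exact hx'.2.1
            · exact D.before_trans ((ih₂ z x' hz hx'.1).2 h) hx'.2.1
        · rw [hcode, hc'] at hc; cases hc
        · rw [hcode, hc'] at hc; cases hc
        · rw [hcode, hc'] at hc
          exact ⟨Subtype.ext (Sum.inl.inj hc).symm,
            fun z hz => ⟨fun h => absurd h (hx' z hz), fun h => absurd h (hy' z hz)⟩⟩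
      have hmap : ∀ x : {x : Point // x ∈ P ∧ x ∉ hullVertices P}, rank x.1 < k + 1 →
          D.map x = D'.map x := by
        intro x hx
        rcases Nat.lt_succ_iff_lt_or_eq.1 hx with hx | hx
        · exact ih₁ x hx
        · exact (new x hx).1
      refine ⟨hmap, fun x y hx hy => ?_⟩
      rcases Nat.lt_succ_iff_lt_or_eq.1 hx with hx' | hx' <;>
      rcases Nat.lt_succ_iff_lt_or_eq.1 hy with hy' | hy'
      · exact ih₂ x y hx' hy'
      · exact (new y hy').2 x hx'
      · have hswap := (new x hx').2 y hy'
        have hne : x ≠ y := by rintro rfl; omega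
        -- By trichotomy in the fiber, what comes after the new point is determined by the map and
        -- by what comes before it.
        have flip : ∀ E : OrderedDowndraft P Q, E.Before x y ↔ E.map x = E.map y ∧ ¬ E.Before y x := by
          intro E
          refine ⟨fun h => ⟨h.1, fun h' => E.before_irrefl x (E.before_trans h h')⟩, ?_⟩
          rintro ⟨h, h'⟩
          exact (E.before_trichotomy h).resolve_right (not_or.2 ⟨hne, h'⟩)
        rw [flip D, flip D', hswap, hmap x hx, hmap y hy]
      · obtain rfl := hinj x y (hx'.trans hy'.symm)
        exact iff_of_false (D.before_irrefl x) (D'.before_irrefl x)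
  refine OrderedDowndraft.ext_before (funext fun x => (key _).1 x (Nat.lt_succ_self _))
    fun x y => (key (max (rank x.1) (rank y.1) + 1)).2 x y ?_ ?_
  · exact Nat.lt_succ_of_le (le_max_left _ _)
  · exact Nat.lt_succ_of_le (le_max_right _ _)

/-- Sorting breaks the ties of `w`, so the points can be inserted one at a time. -/
theorem exists_rank (P : Finset Point) (w : Point → ℕ) :
    ∃ rank : Point → ℕ, Set.InjOn rank P ∧ ∀ x ∈ P, ∀ y ∈ P, rank x < rank y → w x ≤ w y := by
  classical
  obtain ⟨l, hl⟩ : ∃ l : List Point, l = P.toList.mergeSort (fun a b => w a ≤ w b) := ⟨_, rfl⟩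
  have hperm : l.Perm P.toList := hl ▸ List.mergeSort_perm _ _
  have hmem : ∀ x ∈ P, x ∈ l := fun x hx => hperm.mem_iff.2 (by simpa using hx)
  have hsort : l.Pairwise (fun a b => w a ≤ w b) := by
    rw [hl]
    simpa using List.pairwise_mergeSort (le := fun a b => decide (w a ≤ w b))
      (fun a b c h₁ h₂ => by simp only [decide_eq_true_eq] at *; omega)
      (fun a b => by simp only [Bool.or_eq_true, decide_eq_true_eq]; omega) P.toList
  refine ⟨fun x => l.idxOf x, ?_, ?_⟩
  · intro x hx y _ hxy
    exact (List.idxOf_inj (hmem x hx)).1 hxy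
  · intro x hx y hy hlt
    have h₁ := List.idxOf_lt_length_iff.2 (hmem x hx)
    have h₂ := List.idxOf_lt_length_iff.2 (hmem y hy)
    have := List.pairwise_iff_getElem.1 hsort _ _ h₁ h₂ hlt
    simpa using this

/-- If every point is mapped into a region of a laminar family, there are at most twice as many
positions for a point as its region has points. -/
theorem card_orderedDowndraft_le {A : Point → Finset Point}
    (hA : ∀ x ∈ P, x ∈ A x ∧ A x ⊆ P)
    (hlam : ∀ x ∈ P, ∀ y ∈ P, A x ⊆ A y ∨ A y ⊆ A x ∨ Disjoint (A x) (A y))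
    (hprec : ∀ x ∈ P, x ∉ hullVertices P → ∀ y ∈ P, Prec Q x y → y ∈ A x) :
    Nat.card (OrderedDowndraft P Q) ≤ ∏ x ∈ P, (2 * (A x).card) := by
  classical
  obtain ⟨rank, hinj, hrank⟩ := exists_rank P (fun x => (A x).card)
  have hcode : ∀ (D : OrderedDowndraft P Q) x, D.code rank x ∈ (A x.1).disjSum (A x.1) := by
    intro D x
    have hmem : ∀ x, (D.map x).1 ∈ A x.1 := fun x =>
      hprec x.1 x.2.1 x.2.2 _ (D.map x).2 (D.prec_map x)
    rcases D.code_spec rank x with ⟨x', hx', hc⟩ | ⟨-, hc⟩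
    · rw [hc, Finset.inr_mem_disjSum]
      have h₁ := hmem x'
      rw [hx'.2.1.1] at h₁
      -- The regions of `x'` and `x` share the common image of both points, so they are nested. As
      -- `x'` came earlier, its region is not the larger one, and `x'` lies in the region of `x`.
      rcases hlam x'.1 x'.2.1 x.1 x.2.1 with h | h | h
      · exact h (hA x'.1 x'.2.1).1
      · rw [Finset.eq_of_subset_of_card_le h (hrank _ x'.2.1 _ x.2.1 hx'.1)]
        exact (hA x'.1 x'.2.1).1
      · exact absurd (hmem x) (Finset.disjoint_left.1 h h₁)
    · rw [hc, Finset.inl_mem_disjSum]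
      exact hmem x
  have h₁ : Nat.card (OrderedDowndraft P Q) ≤ (Fintype.piFinset
      fun x : {x : Point // x ∈ P ∧ x ∉ hullVertices P} => (A x.1).disjSum (A x.1)).card := by
    rw [← Fintype.card_coe, ← Nat.card_eq_fintype_card]
    refine Nat.card_le_card_of_injective
      (fun D => ⟨D.code rank, Fintype.mem_piFinset.2 (hcode D)⟩) ?_
    intro D D' h
    exact OrderedDowndraft.code_injective hinj (congrArg Subtype.val h)
  refine h₁.trans ?_
  rw [Fintype.card_piFinset]
  have h₂ : ∏ x : {x : Point // x ∈ P ∧ x ∉ hullVertices P}, ((A x.1).disjSum (A x.1)).card =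
      ∏ x ∈ P.filter (fun x => x ∉ hullVertices P), (2 * (A x).card) := by
    rw [← Finset.prod_subtype (P.filter (fun x => x ∉ hullVertices P)) (by simp)
      (fun x => ((A x).disjSum (A x)).card)]
    exact Finset.prod_congr rfl fun x _ => by rw [Finset.card_disjSum, two_mul]
  rw [h₂]
  -- Hull vertices only contribute additional factors that are at least `1`.
  refine Finset.prod_le_prod_of_subset_of_one_le' (Finset.filter_subset _ _) fun x hx _ => ?_
  have := Finset.card_pos.2 ⟨x, (hA x hx).1⟩
  omega

end Counting

/-! ### The running time -/

theorem Rooted.root_mem_hullVertices {ε : ℝ} {P : Finset Point} {p q : Point}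
    (h : Rooted ε P p q) : p ∈ hullVertices P ∧ q ∈ hullVertices P := by
  by_cases hpq : p = q
  · subst hpq
    have : p ∈ hullVertices P := by
      rw [h.eq_singleton]
      have := Module.punctured_nhds_neBot ℝ Point p
      simp [hullVertices, frontier]
    exact ⟨this, this⟩
  · exact ⟨mem_hullVertices hpq h.left_mem (by simp) h.above,
      mem_hullVertices hpq h.right_mem (by simp) h.above⟩

theorem IsUpperEdge.mem_hullVertices {ε : ℝ} {P : Finset Point} {i j : Point}
    (h : IsUpperEdge ε P i j) : i ∈ hullVertices P ∧ j ∈ hullVertices P := by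
  obtain ⟨hi, hj, hlt, hP⟩ := h
  have hij : j ≠ i := by rintro rfl; exact lt_irrefl _ hlt
  exact ⟨KMS.mem_hullVertices hij hi (by simp) hP, KMS.mem_hullVertices hij hj (by simp) hP⟩

theorem hullVertices_subset (P : Finset Point) : hullVertices P ⊆ P := by
  classical
  exact Finset.filter_subset _ _

/-- The region estimate combined with the logarithm of the counting bound. The term `P.card / 20` is
kept as a reserve for the costs outside of `F`. -/
theorem KTree.sum_card_le {ε : ℝ} {P : Finset Point} {p q : Point} {Q : QTree} {F : ℕ}
    (h : KTree ε P p q Q F) (hR : Rooted ε P p q) :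
    (F : ℝ) / 4 + P.card / 20 ≤ P.card +
      Real.log ((P.card : ℝ) ^ P.card / (Nat.card (OrderedDowndraft P Q) : ℝ)) := by
  obtain ⟨A, hA, hlam, hprec, hsum⟩ :=
    h.exists_regions (V := hullVertices P) fun i j hij => hij.mem_hullVertices
  have hcount := card_orderedDowndraft_le hA hlam hprec
  have hne : Nonempty (OrderedDowndraft P Q) := nonempty_orderedDowndraft fun x hx hxV =>
    h.exists_prec hR.root_mem_hullVertices.1 hR.root_mem_hullVertices.2
      (fun i j hij => hij.mem_hullVertices) hx hxV
  have hpos : 0 < (Nat.card (OrderedDowndraft P Q) : ℝ) := by exact_mod_cast Nat.card_pos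
  have hn : 0 < (P.card : ℝ) := by exact_mod_cast Finset.card_pos.2 ⟨p, hR.left_mem⟩
  have hApos : ∀ x ∈ P, ((A x).card : ℝ) ≠ 0 := fun x hx => by
    exact_mod_cast (Finset.card_pos.2 ⟨x, (hA x hx).1⟩).ne'
  have hlog : Real.log (Nat.card (OrderedDowndraft P Q)) ≤
      P.card * Real.log 2 + ∑ x ∈ P, Real.log (A x).card := by
    have h₁ : (Nat.card (OrderedDowndraft P Q) : ℝ) ≤ ∏ x ∈ P, (2 * ((A x).card : ℝ)) := by
      exact_mod_cast hcount
    refine (Real.log_le_log hpos h₁).trans_eq ?_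
    rw [Real.log_prod fun x hx => mul_ne_zero two_ne_zero (hApos x hx),
      ← nsmul_eq_mul, ← Finset.sum_const, ← Finset.sum_add_distrib]
    exact Finset.sum_congr rfl fun x hx => Real.log_mul two_ne_zero (hApos x hx)
  rw [Real.log_div (pow_pos hn _).ne' hpos.ne', Real.log_pow]
  -- The coefficient of `n` that arises is `log 2 + 1 / 4 < 19 / 20`, which leaves the reserve of `n
  -- / 20`.
  have h2 := mul_le_mul_of_nonneg_left Real.log_two_lt_d9.le hn.le
  linarith

end KMS

theorem mainTheorem3 :
    ∃ c : ℝ, ∀ (P : Finset KMS.Point) (pl pr : KMS.Point),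
      KMS.GeneralPosition P →
      pl ∈ P → pr ∈ P →
      (∀ x ∈ P, KMS.LexLe pl x ∧ KMS.LexLe x pr) →
      (∀ x ∈ P, 0 ≤ KMS.orient pl pr x) →
      ∃ Q : KMS.QTree,
        KMS.IsQuadTree (KMS.hullVertices P) pl pr Q ∧
        ∀ I : List KMS.Point, I.Nodup → I.toFinset = P →
          (KMS.run I).ret.1 = Q ∧
          ((KMS.run I).time : ℝ) ≤
            c * ((P.card : ℝ) +
              Real.log ((P.card : ℝ) ^ P.card / (Nat.card (KMS.OrderedDowndraft P Q) : ℝ))) := by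
  -- `160000 = 4 * 40000` turns `F / 4` into `40000 F`, and the reserve `n / 20` into `8000 n`, more
  -- than the `7 n` needed outside of `F`.
  refine ⟨160000, fun P pl pr hgp hpl hpr hlex habove => ?_⟩
  obtain ⟨ε, hε⟩ := KMS.exists_isTilt P
  have hR : KMS.Rooted ε P pl pr :=
    { gp := hgp
      isTilt := hε
      left_mem := hpl
      right_mem := hpr
      left_le := fun x hx => (hε.lexLe_iff hpl hx).1 (hlex x hx).1
      le_right := fun x hx => (hε.lexLe_iff hx hpr).1 (hlex x hx).2
      above := habove }
  -- `Q` is read off from the run on one arbitrary ordering; `KMS.KTree.unique` shows that every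
  -- other ordering produces it too.
  obtain ⟨F₀, hQ, -⟩ := KMS.run_spec (l := P.toList) (by simpa using hR) P.nodup_toList
  rw [Finset.toList_toFinset] at hQ
  refine ⟨_, hQ.isQuadTree (KMS.hullVertices_subset P) fun i j hij => hij.mem_hullVertices,
    fun I hd hI => ?_⟩
  subst hI
  obtain ⟨F, hF, ht⟩ := KMS.run_spec hR hd
  have hcard := List.toFinset_card_of_nodup hd
  have hpos := Finset.card_pos.2 ⟨pl, hpl⟩
  have hle := hF.sum_card_le hR
  rw [hF.unique hQ] at hle
  refine ⟨hF.unique hQ, ?_⟩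
  have ht' : ((KMS.run I).time : ℝ) ≤ 40000 * F + 7 * I.toFinset.card := by
    exact_mod_cast (by omega : (KMS.run I).time ≤ 40000 * F + 7 * I.toFinset.card)
  have hn : (0 : ℝ) ≤ I.toFinset.card := Nat.cast_nonneg _
  linarith
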